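/- **Setting.** Let $\mathcal H$ be a complex Hilbert space with orthonormal basis $(e^i)_i$, let $I=[a,b]$ with $a<b$, and for each $t\in I$ let $A(t)$ be the generator of a $C_0$-semigroup on $\mathcal H$. Let $E^i=\otimes_{t\in I}e^i$, and let $\mathcal{FD}^2_\otimes=\bigoplus_i \mathcal H^2_\otimes(E^i)$, where $\mathcal H^2_\otimes(E^i)$ is the (incomplete, von Neumann) tensor product of copies of $\mathcal H$ over $t\in I$ with reference vector $E^i$, i.e. the Hilbert space with orthonormal basis the vectors $\otimes_{t}e^{g(t)}$, $g:I\to\{\text{indices}\}$ with $g(t)=i$ for all but finitely many $t$. Let $\mathcal A(t)$ be the operator on $\mathcal{FD}^2_\otimes$ that acts as $A(t)$ in the factor at time $t$ and as the identity in all other factors, and let $D_0$ be the span of the vectors $\otimes_t\varphi_t$ with $\varphi_t\in D(A(t))$ for all $t$ and, for some $i$, $\varphi_t=e^i$ for all but finitely many $t$. For $k\ge 0$ and $t\in I$ let $$\mathbf W_k[t,a]=\int_a^t ds_1\int_a^{s_1}ds_2\cdots\int_a^{s_{k-1}}ds_k\,\mathcal A(s_1)\mathcal A(s_2)\cdots\mathcal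 A(s_k)$$ denote the closed operator on $\mathcal{FD}^2_\otimes$ obtained as the closure of the strong iterated Henstock–Kurzweil integral on $D_0$ (integrands need only be defined outside at most countable sets), with $\mathbf W_0$ the identity, and put $\mathbf Q[t,a]=\mathbf W_1[t,a]=\int_a^t\mathcal A(s)\,ds$. **Theorem.** Suppose that for each $t\in I$ the operator $\mathbf Q[t,a]$ generates a contraction $C_0$-semigroup $\mathbf U^w[t,a]=\exp\{w\mathbf Q[t,a]\}$, $w\ge 0$, on $\mathcal{FD}^2_\otimes$. Then for every $t\in I$: 1. $\mathbf U^w[t,a]$ is asymptotic in the sense of Poincaré: for each $n\ge 0$ and each $\Phi_a\in D\big(\mathbf Q[t,a]^{n+1}\big)$, $$\lim_{w\downarrow 0}w^{-(n+1)}\Big\{\mathbf U^w[t,a]-\sum_{k=0}^n\frac{(w\mathbf Q[t,a])^k}{k!}\Big\}\Phi_a=\frac{\mathbf Q[t,a]^{n+1}}{(n+1)!}\Phi_a .$$ 2. For each $k$ the iterated integrals defining $\mathbf W_k[t,a]$ exist on all of $D_0$ and define a closable operator. For each $n\ge 0$, each $\Phi_a\in D\big(\mathbf Q[t,a]^{n+1}\big)$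 and each $w\ge 0$, the vector $\Phi_a$ lies in $D(\mathbf W_k[t,a])$ for $1\le k\le n$, the vectors $\mathbf U^\xi[t,a]\Phi_a$, $0\le\xi\le w$, lie in $D(\mathbf W_{n+1}[t,a])$, the integral over $\xi$ below exists, and $\Phi(t)=\mathbf U^w[t,a]\Phi_a$ satisfies $$\Phi(t)=\Phi_a+\sum_{k=1}^n w^k\int_a^t ds_1\int_a^{s_1}ds_2\cdots\int_a^{s_{k-1}}ds_k\,\mathcal A(s_1)\cdots\mathcal A(s_k)\,\Phi_a$$ $$\qquad+(n+1)\int_0^w(w-\xi)^n\,d\xi\int_a^t ds_1\int_a^{s_1}ds_2\cdots\int_a^{s_n}ds_{n+1}\,\mathcal A(s_1)\cdots\mathcal A(s_{n+1})\,\mathbf U^\xi[t,a]\Phi_a ,$$ where the iterated time-ordered integrals are the operators $\mathbf W_k[t,a]$, $\mathbf W_{n+1}[t,a]$. -/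

import Mathlib

open Filter Topology MeasureTheory

noncomputable section

namespace FeynmanDyson

/-! ### Semigroups, generators, powers of unbounded operators -/

section Abstract

variable {E : Type*} [NormedAddCommGroup E] [NormedSpace ℂ E]

/-- `S` (restricted to `[0, ∞)`) is a `C₀`-semigroup of bounded operators. -/
structure IsC0Semigroup (S : ℝ → E →L[ℂ] E) : Prop where
  zero : S 0 = ContinuousLinearMap.id ℂ E
  add : ∀ s t : ℝ, 0 ≤ s → 0 ≤ t → S (s + t) = (S s).comp (S t)
  cont : ∀ x : E, ContinuousOn (fun t => S t x) (Set.Ici 0)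

/-- `S` is a `C₀`-semigroup of contractions. -/
structure IsC0ContractionSemigroup (S : ℝ → E →L[ℂ] E) : Prop extends IsC0Semigroup S where
  contraction : ∀ t : ℝ, 0 ≤ t → ‖S t‖ ≤ 1

/-- The operator `Q` (with its domain) is the infinitesimal generator of `S`. -/
def IsGeneratorOf (Q : E →ₗ.[ℂ] E) (S : ℝ → E →L[ℂ] E) : Prop :=
  ∀ x y : E, (x, y) ∈ Q.graph ↔
    Tendsto (fun h : ℝ => ((h : ℂ))⁻¹ • (S h x - x)) (𝓝[>] 0) (𝓝 y)

/-- `IsPow Q k x y`: the vector `x` lies in the domain of `Q ^ k` and `Q ^ k x = y`. -/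
def IsPow (Q : E →ₗ.[ℂ] E) : ℕ → E → E → Prop
  | 0, x, y => y = x
  | k + 1, x, y => ∃ z, IsPow Q k x z ∧ (z, y) ∈ Q.graph

/-- `U w = exp (w Q)` is asymptotic in the sense of Poincaré: for each `n` and each `Φ` in the
domain of `Q ^ (n + 1)` (with `y k = Q ^ k Φ` for `k ≤ n + 1`),
`w ^ (-(n + 1)) (U w - ∑_{k ≤ n} (w Q) ^ k / k!) Φ → Q ^ (n + 1) Φ / (n + 1)!` as `w ↓ 0`. -/
def IsPoincareAsymptotic (Q : E →ₗ.[ℂ] E) (U : ℝ → E →L[ℂ] E) : Prop :=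
  ∀ (n : ℕ) (Φ : E) (y : ℕ → E), (∀ k ≤ n + 1, IsPow Q k Φ (y k)) →
    Tendsto
      (fun w : ℝ => ((w : ℂ) ^ (n + 1))⁻¹ •
        (U w Φ - ∑ k ∈ Finset.range (n + 1), ((w : ℂ) ^ k / (k.factorial : ℂ)) • y k))
      (𝓝[>] 0) (𝓝 (((n + 1).factorial : ℂ)⁻¹ • y (n + 1)))

/-- `v` is the Henstock–Kurzweil integral of `G` over `[a, t]`: a partition
`a = x 0 ≤ τ 0 ≤ x 1 ≤ τ 1 ≤ ⋯ ≤ x n = t` is admissible for the gauge `δ` when each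
`x i, x (i + 1)` lies within `δ (τ i)` of the tag `τ i`. -/
def HasHKIntegral (G : ℝ → E) (a t : ℝ) (v : E) : Prop :=
  ∀ ε > (0 : ℝ), ∃ δ : ℝ → ℝ, (∀ s, 0 < δ s) ∧
    ∀ (n : ℕ) (x τ : ℕ → ℝ), x 0 = a → x n = t →
      (∀ i < n, x i ≤ τ i ∧ τ i ≤ x (i + 1) ∧
        τ i - δ (τ i) < x i ∧ x (i + 1) < τ i + δ (τ i)) →
      ‖∑ i ∈ Finset.range n, ((x (i + 1) - x i : ℝ) : ℂ) • G (τ i) - v‖ < ε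

/-- `v` is the iterated Henstock–Kurzweil integral
`∫_a^t ds₁ ∫_a^{s₁} ds₂ ⋯ ∫_a^{s_{k-1}} ds_k F(s₁, …, s_k)`.
The integrand is a partially defined function, given by its graph: `F [s₁, …, s_k] u` says that
its value at `(s₁, …, s_k)` is `u`. At each integration the integrand must be defined
outside an at most countable set of values of the variable; such sets do not affect the
Henstock–Kurzweil integral. -/
def HasIteratedIntegral {a b : ℝ} :
    ℕ → Set.Icc a b → (List (Set.Icc a b) → E → Prop) → E → Prop
  | 0, _, F, v => F [] v
  | k + 1, t, F, v => ∃ G : ℝ → E,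
      (∃ N : Set (Set.Icc a b), N.Countable ∧
        ∀ s : Set.Icc a b, s ≤ t → s ∉ N →
          HasIteratedIntegral k s (fun l => F (s :: l)) (G s)) ∧
      HasHKIntegral G a t v

end Abstract

/-! ### The Feynman–Dyson space

Let `e` be an orthonormal basis of `H`. The film is `⨁ᵢ H_⊗(Eⁱ)` where `Eⁱ = ⊗_{t ∈ [a,b]} eⁱ` and
`H_⊗(Eⁱ)` is the incomplete (partial) tensor product of copies of `H` over `t ∈ [a,b]` with
reference vector `Eⁱ`. The vectors `⊗_t e (g t)`, where `g t = i` for all but finitely many `t`, form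
an orthonormal basis of `H_⊗(Eⁱ)`, and the Hilbert space is realized as `ℓ²` over these
basis vectors. -/

/-- Label of the basis vector `⊗_t e (val t)` of the summand with reference vector `E^base`. -/
@[ext]
structure FilmIndex (a b : ℝ) (ι : Type*) where
  base : ι
  val : Set.Icc a b → ι
  finite' : {t | val t ≠ base}.Finite

/-- Replace the basis vector in time slot `t` by `e k`. -/
def FilmIndex.update {a b : ℝ} {ι : Type*} (p : FilmIndex a b ι) (t : Set.Icc a b) (k : ι) :
    FilmIndex a b ι where
  base := p.base
  val := Function.update p.val t k
  finite' := by
    refine (p.finite'.insert t).subset fun s hs => ?_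
    by_cases h : s = t
    · exact Or.inl h
    · right
      simpa [Function.update_of_ne h] using hs

/-- The Feynman–Dyson space (film) over a Hilbert space with orthonormal basis indexed by `ι`,
for the time interval `[a, b]`. -/
abbrev FDSpace (a b : ℝ) (ι : Type*) : Type _ := lp (fun _ : FilmIndex a b ι => ℂ) 2

variable {H : Type*} [NormedAddCommGroup H] [InnerProductSpace ℂ H]
variable {ι : Type*} {a b : ℝ}

/-- `Φ = ⊗_t φ t`, where `φ t = e i` for all but finitely many `t`: the coordinates of `Φ` in the
summand with reference vector `Eⁱ` are the products of the coordinates of the `φ t`, and its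
components in the other summands vanish. -/
def IsElementaryTensor (e : HilbertBasis ι ℂ H) (i : ι) (φ : Set.Icc a b → H)
    (Φ : FDSpace a b ι) : Prop :=
  {t | φ t ≠ e i}.Finite ∧
    (∀ p : FilmIndex a b ι, p.base = i → Φ p = ∏ᶠ t, e.repr (φ t) (p.val t)) ∧
    ∀ p : FilmIndex a b ι, p.base ≠ i → Φ p = 0

/-- The common core `D₀`: the span of the elementary tensors `⊗_t φ t` in the film with
`φ t ∈ D(A t)` for all `t`. -/
def coreDomain (e : HilbertBasis ι ℂ H) (A : Set.Icc a b → H →ₗ.[ℂ] H) :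
    Submodule ℂ (FDSpace a b ι) :=
  Submodule.span ℂ {Φ | ∃ (i : ι) (φ : Set.Icc a b → H),
    (∀ t, φ t ∈ (A t).domain) ∧ IsElementaryTensor e i φ Φ}

/-- The graph of the time-ordered operator `𝒜 = I ⊗ ⋯ ⊗ T ⊗ ⋯ ⊗ I` with `T` in time slot `t`:
`Φ` is in its domain with image `Ψ` when, for every choice of basis vectors in the other slots, the
slice `x ∈ H` of `Φ` in slot `t` belongs to the domain of `T` and `T x` is the corresponding
slice of `Ψ`. -/
def TimeOrderedOp (e : HilbertBasis ι ℂ H) (T : H →ₗ.[ℂ] H) (t : Set.Icc a b)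
    (Φ Ψ : FDSpace a b ι) : Prop :=
  ∀ p : FilmIndex a b ι, ∃ x : T.domain,
    (∀ k, e.repr (x : H) k = Φ (p.update t k)) ∧ ∀ k, e.repr (T x) k = Ψ (p.update t k)

/-- `TimeOrderedProd e A Φ [s₁, …, s_k] Ψ`: the vector `𝒜(s₁) 𝒜(s₂) ⋯ 𝒜(s_k) Φ` is defined and
equals `Ψ`. -/
def TimeOrderedProd (e : HilbertBasis ι ℂ H) (A : Set.Icc a b → H →ₗ.[ℂ] H)
    (Φ : FDSpace a b ι) : List (Set.Icc a b) → FDSpace a b ι → Prop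
  | [], Ψ => Ψ = Φ
  | s :: l, Ψ => ∃ Θ, TimeOrderedProd e A Φ l Θ ∧ TimeOrderedOp e (A s) s Θ Ψ

/-- `Ψ = ∫_a^t ds₁ ∫_a^{s₁} ds₂ ⋯ ∫_a^{s_{k-1}} ds_k 𝒜(s₁) 𝒜(s₂) ⋯ 𝒜(s_k) Φ` as a strong iterated
Henstock–Kurzweil integral. -/
def HasTimeOrderedIntegral (e : HilbertBasis ι ℂ H) (A : Set.Icc a b → H →ₗ.[ℂ] H)
    (k : ℕ) (t : Set.Icc a b) (Φ Ψ : FDSpace a b ι) : Prop :=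
  HasIteratedIntegral k t (TimeOrderedProd e A Φ) Ψ

/-- The closure of the graph, on the core `D₀`, of the `k`-fold time-ordered integral. -/
def timeOrderedIntegralGraph (e : HilbertBasis ι ℂ H) (A : Set.Icc a b → H →ₗ.[ℂ] H)
    (k : ℕ) (t : Set.Icc a b) : Submodule ℂ (FDSpace a b ι × FDSpace a b ι) :=
  (Submodule.span ℂ {z | z.1 ∈ coreDomain e A ∧
    HasTimeOrderedIntegral e A k t z.1 z.2}).topologicalClosure

/-- The closed operator
`∫_a^t ds₁ ∫_a^{s₁} ds₂ ⋯ ∫_a^{s_{k-1}} ds_k 𝒜(s₁) 𝒜(s₂) ⋯ 𝒜(s_k)` on the film, the closure of the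
strong iterated integral on `D₀`. -/
def timeOrderedIntegral (e : HilbertBasis ι ℂ H) (A : Set.Icc a b → H →ₗ.[ℂ] H)
    (k : ℕ) (t : Set.Icc a b) : FDSpace a b ι →ₗ.[ℂ] FDSpace a b ι :=
  (timeOrderedIntegralGraph e A k t).toLinearPMap

/-- The time-ordered integral `𝐐[t, a] = ∫_a^t 𝒜(s) ds`. -/
def timeOrderedQ (e : HilbertBasis ι ℂ H) (A : Set.Icc a b → H →ₗ.[ℂ] H)
    (t : Set.Icc a b) : FDSpace a b ι →ₗ.[ℂ] FDSpace a b ι :=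
  timeOrderedIntegral e A 1 t

end FeynmanDyson

end

open Filter Topology MeasureTheory

noncomputable section

namespace FeynmanDyson

/-! ### Tagged partitions as lists -/

/-! The time-ordered integrals are diagonal. Let `Φ` carry `e i` in all but countably many slots.
For such a slot `s`, split `A s (e i)` into its component along `e i` and the rest. The first part
of `𝒜(s) Φ` is a scalar multiple of `Φ`. The second parts, for different `s`, are pairwise
orthogonal, because each is orthogonal to `e i` in a slot where the others still carry `e i`. A
pairwise orthogonal family has Henstock–Kurzweil integral zero (`hasHKIntegral_zero_of_orthogonal`):
by Pythagoras the squared norm of a Riemann sum is quadratic in the lengths attached to the tags,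
and the gauge makes these small. Only the mean `⟨e i, A s (e i)⟩` survives, so `𝐐[t, a]` multiplies
the summand with reference vector `Eⁱ` by the number `c i t`, the integral of that mean.

In the iterated integral the same cancellation leaves `∫ c ^ k / k! dc = c ^ (k + 1) / (k + 1)!`.
This is a chain rule for Henstock–Kurzweil primitives (`hasHKIntegral_comp_mul`), proved from the
Saks–Henstock lemma. Hence the `k`-fold integral is multiplication by `c ^ k / k!` on its maximal
domain (`mem_timeOrderedIntegralGraph`), and it equals `𝐐 ^ k / k!` on the domain of `𝐐 ^ k`.

The numbers `c i t` exist because a generator is densely defined: if a mean were not integrable, the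
domain of `𝐐[t, a]` would lie in the kernel of a coordinate functional. What remains is Taylor's
formula with integral remainder for a semigroup orbit (`IsGeneratorOf.taylor`), which gives both the
asymptotics and the expansion. -/

/-- The list `P` of pairs `(tag, right end point)` is a `δ`-fine tagged partition of `[x, z]`. -/
def IsFine (δ : ℝ → ℝ) : ℝ → List (ℝ × ℝ) → ℝ → Prop
  | x, [], z => x = z
  | x, q :: P, z => (x ≤ q.1 ∧ q.1 ≤ q.2 ∧ q.1 - δ q.1 < x ∧ q.2 < q.1 + δ q.1) ∧ IsFine δ q.2 P z

/-- The sum of `f tag left right` over the blocks of a tagged partition starting at `x`. -/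
def tagSum {M : Type*} [AddCommMonoid M] (f : ℝ → ℝ → ℝ → M) : ℝ → List (ℝ × ℝ) → M
  | _, [] => 0
  | x, q :: P => f q.1 x q.2 + tagSum f q.2 P

/-- The contribution of a block to a Riemann sum. -/
def riemannTerm {E : Type*} [NormedAddCommGroup E] [NormedSpace ℂ E] (G : ℝ → E) :
    ℝ → ℝ → ℝ → E := fun τ x y => ((y - x : ℝ) : ℂ) • G τ

section Partitions

theorem IsFine.le {δ : ℝ → ℝ} : ∀ {P : List (ℝ × ℝ)} {x z : ℝ}, IsFine δ x P z → x ≤ z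
  | [], _, _, h => le_of_eq h
  | _ :: _, _, _, h => (h.1.1.trans h.1.2.1).trans h.2.le

theorem IsFine.mono {δ δ' : ℝ → ℝ} (hδ : ∀ s, δ s ≤ δ' s) :
    ∀ {P : List (ℝ × ℝ)} {x z : ℝ}, IsFine δ x P z → IsFine δ' x P z
  | [], _, _, h => h
  | q :: _, _, _, h => ⟨⟨h.1.1, h.1.2.1, by linarith [h.1.2.2.1, hδ q.1],
      by linarith [h.1.2.2.2, hδ q.1]⟩, IsFine.mono hδ h.2⟩

theorem IsFine.append {δ : ℝ → ℝ} {R : List (ℝ × ℝ)} {y z : ℝ} (hR : IsFine δ y R z) :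
    ∀ {P : List (ℝ × ℝ)} {x : ℝ}, IsFine δ x P y → IsFine δ x (P ++ R) z
  | [], _, h => by cases h; exact hR
  | _ :: _, _, h => ⟨h.1, hR.append h.2⟩

theorem tagSum_append {M : Type*} [AddCommMonoid M] (f : ℝ → ℝ → ℝ → M) {δ : ℝ → ℝ}
    (R : List (ℝ × ℝ)) {y : ℝ} : ∀ {P : List (ℝ × ℝ)} {x : ℝ}, IsFine δ x P y →
      tagSum f x (P ++ R) = tagSum f x P + tagSum f y R
  | [], _, h => by cases h; simp [tagSum]
  | _ :: P, _, h => by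
    simp only [List.cons_append, tagSum, tagSum_append f R h.2, add_assoc]

theorem tagSum_add {M : Type*} [AddCommMonoid M] (f g : ℝ → ℝ → ℝ → M) :
    ∀ (P : List (ℝ × ℝ)) (x : ℝ), tagSum (fun τ x y => f τ x y + g τ x y) x P =
      tagSum f x P + tagSum g x P
  | [], _ => by simp [tagSum]
  | q :: P, _ => by
    simp only [tagSum, tagSum_add f g P]; exact add_add_add_comm _ _ _ _

theorem tagSum_sub {M : Type*} [AddCommGroup M] (f g : ℝ → ℝ → ℝ → M) (P : List (ℝ × ℝ))
    (x : ℝ) : tagSum (fun τ x y => f τ x y - g τ x y) x P = tagSum f x P - tagSum g x P := by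
  rw [eq_sub_iff_add_eq, ← tagSum_add]
  simp only [sub_add_cancel]

theorem map_tagSum {M N : Type*} [AddCommMonoid M] [AddCommMonoid N] (φ : M →+ N)
    (f : ℝ → ℝ → ℝ → M) : ∀ (P : List (ℝ × ℝ)) (x : ℝ),
      φ (tagSum f x P) = tagSum (fun τ x y => φ (f τ x y)) x P
  | [], _ => by simp [tagSum]
  | _ :: P, _ => by simp only [tagSum, map_add, map_tagSum φ f P]

theorem tagSum_telescope {M : Type*} [AddCommGroup M] (F : ℝ → M) {δ : ℝ → ℝ} :
    ∀ {P : List (ℝ × ℝ)} {x z : ℝ}, IsFine δ x P z →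
      tagSum (fun _ x y => F y - F x) x P = F z - F x
  | [], _, _, h => by cases h; simp [tagSum]
  | _ :: P, _, _, h => by simp only [tagSum, tagSum_telescope F h.2]; abel

/-- Comparison of sums over a fine partition, block by block. -/
theorem tagSum_le {δ : ℝ → ℝ} {f g : ℝ → ℝ → ℝ → ℝ} {a b : ℝ}
    (hfg : ∀ τ x y, a ≤ x → x ≤ τ → τ ≤ y → y ≤ b → τ - δ τ < x → y < τ + δ τ →
      f τ x y ≤ g τ x y) :
    ∀ {P : List (ℝ × ℝ)} {x : ℝ}, a ≤ x → IsFine δ x P b → tagSum f x P ≤ tagSum g x P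
  | [], _, _, _ => le_rfl
  | _ :: _, _, hx, h => add_le_add
      (hfg _ _ _ hx h.1.1 h.1.2.1 h.2.le h.1.2.2.1 h.1.2.2.2)
      (tagSum_le hfg (hx.trans (h.1.1.trans h.1.2.1)) h.2)

theorem norm_tagSum_le {E : Type*} [NormedAddCommGroup E] (f : ℝ → ℝ → ℝ → E) :
    ∀ (P : List (ℝ × ℝ)) (x : ℝ), ‖tagSum f x P‖ ≤ tagSum (fun τ x y => ‖f τ x y‖) x P
  | [], _ => by simp [tagSum]
  | _ :: P, _ => (norm_add_le _ _).trans (by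
      simp only [tagSum]; exact add_le_add le_rfl (norm_tagSum_le f P _))

/-- Cousin's lemma. -/
theorem exists_isFine {δ : ℝ → ℝ} (hδ : ∀ s, 0 < δ s) {a b : ℝ} (hab : a ≤ b) :
    ∃ P, IsFine δ a P b := by
  set S : Set ℝ := {y | y ∈ Set.Icc a b ∧ ∃ P, IsFine δ a P y} with hS
  have haS : a ∈ S := ⟨⟨le_rfl, hab⟩, [], rfl⟩
  have hbdd : BddAbove S := ⟨b, fun y hy => hy.1.2⟩
  set c := sSup S with hc
  have hac : a ≤ c := le_csSup hbdd haS
  have hcb : c ≤ b := csSup_le ⟨a, haS⟩ fun y hy => hy.1.2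
  obtain ⟨y, ⟨hy, P, hP⟩, hyc⟩ := exists_lt_of_lt_csSup ⟨a, haS⟩
    (show c - δ c < sSup S by linarith [hδ c])
  have hyc' : y ≤ c := le_csSup hbdd ⟨hy, P, hP⟩
  have key : ∀ z, c ≤ z → z < c + δ c → IsFine δ a (P ++ [(c, z)]) z := fun z h1 h2 =>
    IsFine.append (show IsFine δ y [(c, z)] z from ⟨⟨hyc', h1, hyc, h2⟩, rfl⟩) hP
  rcases hcb.eq_or_lt with h | h
  · exact ⟨_, h ▸ key c le_rfl (by linarith [hδ c])⟩
  · have hz : min b (c + δ c / 2) ∈ S :=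
      ⟨⟨le_min hab (by linarith [hδ c]), min_le_left _ _⟩, _,
        key _ (le_min hcb (by linarith [hδ c]))
          ((min_le_right _ _).trans_lt (by linarith [hδ c]))⟩
    have h1 : min b (c + δ c / 2) ≤ c := le_csSup hbdd hz
    have h2 : c < min b (c + δ c / 2) := lt_min h (by linarith [hδ c])
    exact absurd h1 (not_le.2 h2)

/-- The total length of the blocks with tag `σ`. -/
def tagLength (σ : ℝ) (x : ℝ) (P : List (ℝ × ℝ)) : ℝ :=
  tagSum (fun τ x y => if τ = σ then y - x else 0) x P

/-- Every block tagged `σ` lies within `δ σ` of `σ`. Truncating the identity to this window gives a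
monotone function whose increments telescope and dominate these block lengths. -/
theorem tagLength_le {δ : ℝ → ℝ} (hδ : ∀ s, 0 < δ s) (σ : ℝ) {P : List (ℝ × ℝ)} {x z : ℝ}
    (h : IsFine δ x P z) : tagLength σ x P ≤ 2 * δ σ := by
  set F : ℝ → ℝ := fun u => max (σ - δ σ) (min u (σ + δ σ)) with hF
  have hmono : Monotone F := fun u v huv => max_le_max le_rfl (min_le_min huv le_rfl)
  have h1 : tagLength σ x P ≤ tagSum (fun _ x y => F y - F x) x P := by
    refine tagSum_le (a := x) ?_ le_rfl h
    intro τ u y _ h1 h2 _ h3 h4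
    split_ifs with hτ
    · subst hτ
      have e1 : F u = u := by
        simp only [hF]; rw [min_eq_left (by linarith), max_eq_right h3.le]
      have e2 : F y = y := by
        simp only [hF]; rw [min_eq_left h4.le, max_eq_right (by linarith)]
      rw [e1, e2]
    · exact sub_nonneg.2 (hmono (h1.trans h2))
  rw [tagSum_telescope F h] at h1
  have h2 : F z ≤ σ + δ σ := max_le (by linarith [hδ σ]) (min_le_right _ _)
  have h3 : σ - δ σ ≤ F x := le_max_left _ _
  linarith

/-- Grouping the blocks of a partition by their tags. -/
theorem tagSum_eq_sum_tagLength (h : ℝ → ℝ) (T : Finset ℝ) : ∀ (P : List (ℝ × ℝ)) (x : ℝ),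
    (∀ q ∈ P, q.1 ∈ T) →
      tagSum (fun τ x y => (y - x) * h τ) x P = ∑ σ ∈ T, tagLength σ x P * h σ
  | [], _, _ => by simp [tagLength, tagSum]
  | q :: P, x, hT => by
    have ih := tagSum_eq_sum_tagLength h T P q.2 fun r hr => hT r (List.mem_cons_of_mem _ hr)
    simp only [tagLength, tagSum] at ih ⊢
    rw [ih]
    simp only [add_mul, Finset.sum_add_distrib, ite_mul, zero_mul, Finset.sum_ite_eq,
      if_pos (hT q List.mem_cons_self)]

end Partitions

/-! ### Elementary properties of the Henstock–Kurzweil integral -/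

section HK

variable {E : Type*} [NormedAddCommGroup E] [NormedSpace ℂ E]

theorem exists_list_of_partition {E : Type*} [AddCommMonoid E] (f : ℝ → ℝ → ℝ → E) (δ : ℝ → ℝ) :
    ∀ (n : ℕ) (x τ : ℕ → ℝ), (∀ i < n, x i ≤ τ i ∧ τ i ≤ x (i + 1) ∧
        τ i - δ (τ i) < x i ∧ x (i + 1) < τ i + δ (τ i)) →
      ∃ P, IsFine δ (x 0) P (x n) ∧
        tagSum f (x 0) P = ∑ i ∈ Finset.range n, f (τ i) (x i) (x (i + 1))
  | 0, _, _, _ => ⟨[], rfl, by simp [tagSum]⟩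
  | n + 1, x, τ, h => by
    obtain ⟨P, hP, hS⟩ := exists_list_of_partition f δ n (fun i => x (i + 1)) (fun i => τ (i + 1))
      fun i hi => h (i + 1) (by omega)
    refine ⟨(τ 0, x 1) :: P, ⟨h 0 (by omega), hP⟩, ?_⟩
    rw [Finset.sum_range_succ', ← hS, add_comm]
    rfl

theorem exists_partition_of_list {E : Type*} [AddCommMonoid E] (f : ℝ → ℝ → ℝ → E) (δ : ℝ → ℝ) :
    ∀ (P : List (ℝ × ℝ)) (a t : ℝ), IsFine δ a P t →
      ∃ (n : ℕ) (x τ : ℕ → ℝ), x 0 = a ∧ x n = t ∧ (∀ i < n, x i ≤ τ i ∧ τ i ≤ x (i + 1) ∧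
        τ i - δ (τ i) < x i ∧ x (i + 1) < τ i + δ (τ i)) ∧
        tagSum f a P = ∑ i ∈ Finset.range n, f (τ i) (x i) (x (i + 1))
  | [], a, _, h => ⟨0, fun _ => a, fun _ => a, rfl, h, by simp, by simp [tagSum]⟩
  | q :: P, a, t, h => by
    obtain ⟨n, x, τ, h0, hn, hx, hS⟩ := exists_partition_of_list f δ P q.2 t h.2
    refine ⟨n + 1, fun i => Nat.casesOn i a x, fun i => Nat.casesOn i q.1 τ, rfl, hn, ?_, ?_⟩
    · rintro (_ | i) hi
      · simpa [h0] using h.1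
      · exact hx i (by omega)
    · rw [Finset.sum_range_succ', add_comm]
      simp only [tagSum, hS, h0]
      rfl

theorem hasHKIntegral_iff {G : ℝ → E} {a t : ℝ} {v : E} :
    HasHKIntegral G a t v ↔ ∀ ε > (0 : ℝ), ∃ δ : ℝ → ℝ, (∀ s, 0 < δ s) ∧
      ∀ P, IsFine δ a P t → ‖tagSum (riemannTerm G) a P - v‖ < ε := by
  refine forall₂_congr fun ε _ => exists_congr fun δ => and_congr_right fun _ => ⟨?_, ?_⟩
  · intro h P hP
    obtain ⟨n, x, τ, h0, hn, hx, hS⟩ := exists_partition_of_list (riemannTerm G) δ P a t hP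
    rw [hS]
    exact h n x τ h0 hn hx
  · rintro h n x τ rfl rfl hx
    obtain ⟨P, hP, hS⟩ := exists_list_of_partition (riemannTerm G) δ n x τ hx
    have := h P hP
    rw [hS] at this
    exact this

/-- Cousin's lemma supplies a partition fine for both gauges at once. -/
theorem HasHKIntegral.unique {G : ℝ → E} {a t : ℝ} (hat : a ≤ t) {v v' : E}
    (h : HasHKIntegral G a t v) (h' : HasHKIntegral G a t v') : v = v' := by
  rw [hasHKIntegral_iff] at h h'
  by_contra hne
  have hpos : 0 < ‖v - v'‖ / 2 := half_pos (norm_pos_iff.2 (sub_ne_zero.2 hne))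
  obtain ⟨δ, hδ, H⟩ := h _ hpos
  obtain ⟨δ', hδ', H'⟩ := h' _ hpos
  obtain ⟨P, hP⟩ := exists_isFine (δ := fun s => min (δ s) (δ' s))
    (fun s => lt_min (hδ s) (hδ' s)) hat
  have h1 := H P (hP.mono fun s => min_le_left _ _)
  have h2 := H' P (hP.mono fun s => min_le_right _ _)
  have h3 : v - v' = (tagSum (riemannTerm G) a P - v') - (tagSum (riemannTerm G) a P - v) := by
    abel
  have h4 := norm_sub_le (tagSum (riemannTerm G) a P - v') (tagSum (riemannTerm G) a P - v)
  rw [← h3] at h4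
  linarith

theorem HasHKIntegral.add {G G' : ℝ → E} {a t : ℝ} {v v' : E}
    (h : HasHKIntegral G a t v) (h' : HasHKIntegral G' a t v') :
    HasHKIntegral (fun s => G s + G' s) a t (v + v') := by
  rw [hasHKIntegral_iff] at h h' ⊢
  intro ε hε
  obtain ⟨δ, hδ, H⟩ := h _ (half_pos hε)
  obtain ⟨δ', hδ', H'⟩ := h' _ (half_pos hε)
  refine ⟨fun s => min (δ s) (δ' s), fun s => lt_min (hδ s) (hδ' s), fun P hP => ?_⟩
  have h1 := H P (hP.mono fun s => min_le_left _ _)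
  have h2 := H' P (hP.mono fun s => min_le_right _ _)
  have h3 : tagSum (riemannTerm fun s => G s + G' s) a P
      = tagSum (riemannTerm G) a P + tagSum (riemannTerm G') a P := by
    rw [← tagSum_add]; simp only [riemannTerm, ← smul_add]; rfl
  rw [h3, add_sub_add_comm]
  exact (norm_add_le _ _).trans_lt (by linarith)

/-- Continuous linear maps commute with the integral. -/
theorem HasHKIntegral.map {F : Type*} [NormedAddCommGroup F] [NormedSpace ℂ F] (L : E →L[ℂ] F)
    {G : ℝ → E} {a t : ℝ} {v : E} (h : HasHKIntegral G a t v) :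
    HasHKIntegral (fun s => L (G s)) a t (L v) := by
  rw [hasHKIntegral_iff] at h ⊢
  intro ε hε
  have hL : 0 < ‖L‖ + 1 := by positivity
  obtain ⟨δ, hδ, H⟩ := h (ε / (‖L‖ + 1)) (div_pos hε hL)
  refine ⟨δ, hδ, fun P hP => ?_⟩
  have h3 : tagSum (riemannTerm fun s => L (G s)) a P = L (tagSum (riemannTerm G) a P) := by
    have := map_tagSum (L : E →+ F) (riemannTerm G) P a
    simp only [riemannTerm, AddMonoidHom.coe_coe, map_smul] at this
    exact this.symm
  rw [h3, ← map_sub]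
  calc _ ≤ ‖L‖ * ‖tagSum (riemannTerm G) a P - v‖ := L.le_opNorm _
    _ ≤ (‖L‖ + 1) * ‖tagSum (riemannTerm G) a P - v‖ := by gcongr; linarith
    _ < (‖L‖ + 1) * (ε / (‖L‖ + 1)) := by gcongr; exact H P hP
    _ = ε := by field_simp

theorem HasHKIntegral.const_smul {G : ℝ → E} {a t : ℝ} {v : E} (z : ℂ)
    (h : HasHKIntegral G a t v) : HasHKIntegral (fun s => z • G s) a t (z • v) :=
  h.map (z • ContinuousLinearMap.id ℂ E)

theorem HasHKIntegral.smul_const {f : ℝ → ℂ} {a t : ℝ} {v : ℂ}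
    (h : HasHKIntegral f a t v) (x : E) : HasHKIntegral (fun s => f s • x) a t (v • x) :=
  h.map ((ContinuousLinearMap.id ℂ ℂ).smulRight x)

/-- Give the points of `N` weights of total at most `ε / 2` and let the gauge at `s` be proportional
to `w s / (1 + ‖G s‖)`. All blocks tagged `s` together then contribute at most `w s`. -/
theorem hasHKIntegral_zero_of_countable {G : ℝ → E} {a t : ℝ} {N : Set ℝ} (hN : N.Countable)
    (hG : ∀ s ∈ Set.Icc a t, s ∉ N → G s = 0) : HasHKIntegral G a t 0 := by
  classical
  rw [hasHKIntegral_iff]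
  intro ε hε
  obtain ⟨w, hw, hsum⟩ := hN.exists_pos_forall_sum_le (half_pos hε)
  have hpos : ∀ s, 0 < w s / (2 * (1 + ‖G s‖)) := fun s => div_pos (hw s) (by positivity)
  refine ⟨fun s => w s / (2 * (1 + ‖G s‖)), hpos, fun P hP => ?_⟩
  rw [sub_zero]
  set T : Finset ℝ := (P.map Prod.fst).toFinset
  have hT : ∀ q ∈ P, q.1 ∈ T := fun q hq => List.mem_toFinset.2 (List.mem_map_of_mem hq)
  set g : ℝ → ℝ := fun σ => if σ ∈ N then ‖G σ‖ else 0
  calc ‖tagSum (riemannTerm G) a P‖ ≤ tagSum (fun τ x y => ‖riemannTerm G τ x y‖) a P :=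
        norm_tagSum_le _ _ _
    _ ≤ tagSum (fun τ x y => (y - x) * g τ) a P := by
        refine tagSum_le (a := a) ?_ le_rfl hP
        intro τ x y h1 h2 h3 h4 _ _
        simp only [riemannTerm, norm_smul, Complex.norm_real, Real.norm_eq_abs,
          abs_of_nonneg (sub_nonneg.2 (h2.trans h3)), g]
        split_ifs with h
        · exact le_rfl
        · simp [hG τ ⟨h1.trans h2, h3.trans h4⟩ h]
    _ = ∑ σ ∈ T, tagLength σ a P * g σ := tagSum_eq_sum_tagLength g T P a hT
    _ ≤ ∑ σ ∈ T, if σ ∈ N then w σ else 0 := by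
        refine Finset.sum_le_sum fun σ _ => ?_
        have h1 := tagLength_le hpos σ hP
        simp only [g]
        split_ifs with h
        · calc tagLength σ a P * ‖G σ‖ ≤ (2 * (w σ / (2 * (1 + ‖G σ‖)))) * (1 + ‖G σ‖) := by
                gcongr
                · exact (mul_pos two_pos (hpos σ)).le
                · linarith
            _ = w σ := by
                have : 1 + ‖G σ‖ ≠ 0 := by positivity
                field_simp
        · simp
    _ = ∑ σ ∈ T with σ ∈ N, w σ := (Finset.sum_filter _ _).symm
    _ ≤ ε / 2 := hsum _ fun σ hσ => (Finset.mem_filter.1 (Finset.mem_coe.1 hσ)).2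
    _ < ε := half_lt_self hε

/-- Countable sets do not affect the Henstock–Kurzweil integral. -/
theorem HasHKIntegral.congr {G G' : ℝ → E} {a t : ℝ} {v : E} {N : Set ℝ} (hN : N.Countable)
    (h : HasHKIntegral G a t v) (hG : ∀ s ∈ Set.Icc a t, s ∉ N → G s = G' s) :
    HasHKIntegral G' a t v := by
  have := h.add (hasHKIntegral_zero_of_countable (G := fun s => G' s - G s) hN
    fun s hs hsN => by simp [hG s hs hsN])
  simpa using this

end HK

/-! ### Orthogonal families have integral zero -/

section Orthogonal

variable {E : Type*} [NormedAddCommGroup E] [InnerProductSpace ℂ E]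

/-- A family of pairwise orthogonal vectors integrates to zero. -/
theorem hasHKIntegral_zero_of_orthogonal {G : ℝ → E} (a t : ℝ)
    (hG : ∀ s s', s ≠ s' → inner ℂ (G s) (G s') = 0) : HasHKIntegral G a t 0 := by
  rw [hasHKIntegral_iff]
  intro ε hε
  set η : ℝ := ε ^ 2 / (2 * (|t - a| + 1))
  have hη : 0 < η := by positivity
  have hpos : ∀ s, 0 < η / (2 * (1 + ‖G s‖ ^ 2)) := fun s => div_pos hη (by positivity)
  refine ⟨fun s => η / (2 * (1 + ‖G s‖ ^ 2)), hpos, fun P hP => ?_⟩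
  rw [sub_zero]
  set S := tagSum (riemannTerm G) a P with hS
  -- By orthogonality, only blocks tagged `σ` are seen by `G σ`.
  have inner_eq : ∀ σ, inner ℂ (G σ) S = ((tagLength σ a P * ‖G σ‖ ^ 2 : ℝ) : ℂ) := by
    intro σ
    have h1 := map_tagSum (innerSL ℂ (G σ) : E →+ ℂ) (riemannTerm G) P a
    have h2 := map_tagSum ((Complex.ofRealHom : ℝ →+ ℂ).comp (AddMonoidHom.mulRight (‖G σ‖ ^ 2)))
      (fun τ x y => if τ = σ then y - x else 0) P a
    simp only [AddMonoidHom.coe_coe, innerSL_apply_apply, AddMonoidHom.comp_apply,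
      AddMonoidHom.coe_mulRight] at h1 h2
    rw [hS, h1]
    refine Eq.trans ?_ h2.symm
    congr 1
    funext τ x y
    simp only [riemannTerm, inner_smul_right]
    split_ifs with h
    · subst h
      rw [inner_self_eq_norm_sq_to_K]
      simp
    · rw [hG _ _ (Ne.symm h)]; simp
  -- Each term carries two lengths: the gauge turns `tagLength τ * ‖G τ‖ ^ 2` into at most `η`,
  -- while the block length `y - x` remains and telescopes to `t - a`.
  have h1 : ‖S‖ ^ 2 = tagSum (fun τ x y => (y - x) * (tagLength τ a P * ‖G τ‖ ^ 2)) a P := by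
    have h1 := map_tagSum (AddMonoidHom.mk' (fun x : E => (inner ℂ x S).re)
      fun x y => by rw [inner_add_left, Complex.add_re]) (riemannTerm G) P a
    simp only [AddMonoidHom.mk'_apply] at h1
    rw [← inner_self_eq_norm_sq (𝕜 := ℂ)]
    refine h1.trans ?_
    congr 1
    funext τ x y
    rw [riemannTerm, inner_smul_left, inner_eq, Complex.conj_ofReal, ← Complex.ofReal_mul,
      Complex.ofReal_re]
  have h2 : ‖S‖ ^ 2 ≤ tagSum (fun _ x y => η * y - η * x) a P := by
    rw [h1]
    refine tagSum_le (a := a) ?_ le_rfl hP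
    intro τ x y _ h2 h3 _ _ _
    rw [← mul_sub, mul_comm η]
    refine mul_le_mul_of_nonneg_left ?_ (sub_nonneg.2 (h2.trans h3))
    have h4 := tagLength_le hpos τ hP
    calc tagLength τ a P * ‖G τ‖ ^ 2
        ≤ (2 * (η / (2 * (1 + ‖G τ‖ ^ 2)))) * (1 + ‖G τ‖ ^ 2) := by
          gcongr
          linarith
      _ = η := by
          have : 1 + ‖G τ‖ ^ 2 ≠ 0 := by positivity
          field_simp
  rw [tagSum_telescope (fun x => η * x) hP, ← mul_sub] at h2
  have h3 : η * (t - a) < ε ^ 2 := by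
    calc η * (t - a) ≤ η * (|t - a| + 1) := by
          gcongr; linarith [le_abs_self (t - a)]
      _ = ε ^ 2 / 2 := by simp only [η]; field_simp
      _ < ε ^ 2 := by linarith [pow_pos hε 2]
  exact lt_of_pow_lt_pow_left₀ 2 hε.le (h2.trans_lt h3)

end Orthogonal

/-! ### Indefinite Henstock–Kurzweil integrals and the chain rule -/

section Indefinite

variable {α c : ℝ → ℂ} {a b : ℝ}

/-- The defect of a block with respect to an indefinite integral `c` of `α`. -/
def blockDefect (α c : ℝ → ℂ) : ℝ → ℝ → ℝ → ℂ :=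
  fun τ x y => riemannTerm α τ x y - (c y - c x)

theorem tagSum_blockDefect {δ : ℝ → ℝ} {P : List (ℝ × ℝ)} {x z : ℝ} (h : IsFine δ x P z) :
    tagSum (blockDefect α c) x P = tagSum (riemannTerm α) x P - (c z - c x) := by
  rw [← tagSum_telescope c h, ← tagSum_sub]
  rfl

theorem indefinite_start (hc : ∀ t ∈ Set.Icc a b, HasHKIntegral α a t (c t))
    (hab : a ≤ b) : c a = 0 := by
  refine (hc a ⟨le_rfl, hab⟩).unique le_rfl ?_
  refine hasHKIntegral_zero_of_countable (Set.countable_singleton a) fun s hs hsN => ?_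
  exact absurd (le_antisymm hs.2 hs.1) hsN

/-- The increment `c y - c x` is approximated on `[x, y]` by prefixing a partition of `[a, x]` that
is fine for the integrals up to `x` and up to `y`, then subtracting its sum. -/
theorem exists_isFine_blockDefect_lt (hc : ∀ t ∈ Set.Icc a b, HasHKIntegral α a t (c t))
    {δ : ℝ → ℝ} (hδ : ∀ s, 0 < δ s) {x y ε : ℝ} (hε : 0 < ε)
    (hax : a ≤ x) (hxy : x ≤ y) (hyb : y ≤ b) :
    ∃ P, IsFine δ x P y ∧ ‖tagSum (blockDefect α c) x P‖ < ε := by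
  obtain ⟨δ₁, hδ₁, H₁⟩ := hasHKIntegral_iff.1 (hc x ⟨hax, hxy.trans hyb⟩) _ (half_pos hε)
  obtain ⟨δ₂, hδ₂, H₂⟩ := hasHKIntegral_iff.1 (hc y ⟨hax.trans hxy, hyb⟩) _ (half_pos hε)
  have hm : ∀ s, 0 < min (δ s) (min (δ₁ s) (δ₂ s)) := fun s =>
    lt_min (hδ s) (lt_min (hδ₁ s) (hδ₂ s))
  obtain ⟨R, hR⟩ := exists_isFine hm hax
  obtain ⟨P, hP⟩ := exists_isFine hm hxy
  refine ⟨P, hP.mono fun s => min_le_left _ _, ?_⟩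
  have h1 := H₁ R (hR.mono fun s => (min_le_right _ _).trans (min_le_left _ _))
  have h2 := H₂ (R ++ P) ((hP.append hR).mono fun s => (min_le_right _ _).trans (min_le_right _ _))
  rw [tagSum_append _ _ hR] at h2
  rw [tagSum_blockDefect hP]
  have h3 : tagSum (riemannTerm α) x P - (c y - c x) =
      (tagSum (riemannTerm α) a R + tagSum (riemannTerm α) x P - c y)
        - (tagSum (riemannTerm α) a R - c x) := by abel
  rw [h3]
  exact (norm_sub_le _ _).trans_lt (by linarith)

/-- Blocks whose defect has a negative `L`-part are replaced by fine partitions of negligible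
defect. Bounds on whole sums thereby become bounds on sums of positive parts, the core of the
Saks–Henstock argument. -/
theorem exists_isFine_posPart_le (hc : ∀ t ∈ Set.Icc a b, HasHKIntegral α a t (c t))
    {δ : ℝ → ℝ} (hδ : ∀ s, 0 < δ s) (L : ℂ →+ ℝ)
    (hL : ∀ z, |L z| ≤ ‖z‖) {z : ℝ} (hzb : z ≤ b) :
    ∀ (P : List (ℝ × ℝ)) (x η : ℝ), 0 < η → a ≤ x → IsFine δ x P z →
      ∃ R, IsFine δ x R z ∧ tagSum (fun τ x y => max (L (blockDefect α c τ x y)) 0) x P ≤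
        L (tagSum (blockDefect α c) x R) + η
  | [], _, η, hη, _, h => ⟨[], h, by simp [tagSum, hη.le]⟩
  | q :: P, x, η, hη, hax, h => by
    have hxq := h.1.1.trans h.1.2.1
    obtain ⟨R, hR, hle⟩ := exists_isFine_posPart_le hc hδ L hL hzb P q.2 (η / 2) (half_pos hη)
      (hax.trans hxq) h.2
    rcases le_total 0 (L (blockDefect α c q.1 x q.2)) with h0 | h0
    · refine ⟨q :: R, ⟨h.1, hR⟩, ?_⟩
      simp only [tagSum, map_add, max_eq_left h0]
      linarith
    · obtain ⟨R', hR', hlt⟩ := exists_isFine_blockDefect_lt hc hδ (half_pos hη) hax hxq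
        (h.2.le.trans hzb)
      refine ⟨R' ++ R, hR.append hR', ?_⟩
      rw [tagSum_append _ _ hR']
      simp only [tagSum, map_add, max_eq_right h0]
      have := (abs_le.1 (hL (tagSum (blockDefect α c) x R'))).1
      linarith

/-- The Saks–Henstock lemma. -/
theorem saks_henstock (hc : ∀ t ∈ Set.Icc a b, HasHKIntegral α a t (c t))
    (hab : a ≤ b) {t : ℝ} (ht : t ∈ Set.Icc a b) {ε : ℝ} (hε : 0 < ε) :
    ∃ δ : ℝ → ℝ, (∀ s, 0 < δ s) ∧ ∀ P, IsFine δ a P t →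
      tagSum (fun τ x y => ‖blockDefect α c τ x y‖) a P ≤ ε := by
  -- One quarter for each of the functionals `± re` and `± im`, whose positive parts together
  -- dominate the norm.
  obtain ⟨δ, hδ, H⟩ := hasHKIntegral_iff.1 (hc t ht) (ε / 4) (by positivity)
  refine ⟨δ, hδ, fun P hP => ?_⟩
  have key : ∀ L : ℂ →+ ℝ, (∀ z, |L z| ≤ ‖z‖) →
      tagSum (fun τ x y => max (L (blockDefect α c τ x y)) 0) a P ≤ ε / 4 := by
    intro L hL
    refine le_of_forall_pos_le_add fun η hη => ?_
    obtain ⟨R, hR, hle⟩ := exists_isFine_posPart_le hc hδ L hL ht.2 P a η hη le_rfl hP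
    have h1 := H R hR
    have h2 := (le_abs_self _).trans (hL (tagSum (blockDefect α c) a R))
    rw [tagSum_blockDefect hR, indefinite_start hc hab, sub_zero] at h2
    rw [tagSum_blockDefect hR, indefinite_start hc hab, sub_zero] at hle
    linarith
  have h1 := key Complex.reAddGroupHom Complex.abs_re_le_norm
  have h2 := key (-Complex.reAddGroupHom) fun z => by simpa using Complex.abs_re_le_norm z
  have h3 := key Complex.imAddGroupHom Complex.abs_im_le_norm
  have h4 := key (-Complex.imAddGroupHom) fun z => by simpa using Complex.abs_im_le_norm z
  have h5 := add_le_add (add_le_add h1 h2) (add_le_add h3 h4)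
  simp only [← tagSum_add] at h5
  refine le_trans (tagSum_le (a := a) ?_ le_rfl hP) (h5.trans (by linarith))
  intro τ x y _ _ _ _ _ _
  refine (Complex.norm_le_abs_re_add_abs_im _).trans (le_of_eq ?_)
  set z := blockDefect α c τ x y
  have h : ∀ r : ℝ, |r| = max r 0 + max (-r) 0 := fun r => by
    rcases le_total 0 r with h | h <;> simp [h, abs_of_nonneg, abs_of_nonpos]
  rw [h, h]
  rfl

/-- A single fine block has a small defect. -/
theorem exists_gauge_block (hc : ∀ t ∈ Set.Icc a b, HasHKIntegral α a t (c t))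
    (hab : a ≤ b) {t : ℝ} (ht : t ∈ Set.Icc a b) {ε : ℝ} (hε : 0 < ε) :
    ∃ δ : ℝ → ℝ, (∀ s, 0 < δ s) ∧ ∀ τ x y, a ≤ x → x ≤ τ → τ ≤ y → y ≤ t →
      τ - δ τ < x → y < τ + δ τ → ‖blockDefect α c τ x y‖ ≤ ε := by
  obtain ⟨δ, hδ, H⟩ := saks_henstock hc hab ht hε
  refine ⟨δ, hδ, fun τ x y hax hxτ hτy hyt h1 h2 => ?_⟩
  obtain ⟨P, hP⟩ := exists_isFine hδ hax
  obtain ⟨R, hR⟩ := exists_isFine hδ hyt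
  have hR' : IsFine δ x ((τ, y) :: R) t := ⟨⟨hxτ, hτy, h1, h2⟩, hR⟩
  have h3 := H _ (hR'.append hP)
  rw [tagSum_append _ _ hP] at h3
  have h4 := (norm_nonneg _).trans (norm_tagSum_le (blockDefect α c) P a)
  have h5 := (norm_nonneg _).trans (norm_tagSum_le (blockDefect α c) R y)
  simp only [tagSum] at h3
  linarith

/-- Take a block with one end at its tag `τ`: the defect is small by the gauge, and the Riemann term
is small because its length times `‖α τ‖` is. -/
theorem continuousOn_indefinite (hc : ∀ t ∈ Set.Icc a b, HasHKIntegral α a t (c t))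
    (hab : a ≤ b) : ContinuousOn c (Set.Icc a b) := by
  intro τ hτ
  rw [Metric.continuousWithinAt_iff]
  intro ε hε
  obtain ⟨δ, hδ, H⟩ := exists_gauge_block hc hab ⟨hab, le_rfl⟩ (half_pos hε)
  have hp : 0 < ε / (2 * (‖α τ‖ + 1)) := by positivity
  refine ⟨min (δ τ) (ε / (2 * (‖α τ‖ + 1))), lt_min (hδ τ) hp, fun y hy hd => ?_⟩
  have hd1 := hd.trans_le (min_le_left _ _)
  have hd2 := hd.trans_le (min_le_right _ _)
  rw [Real.dist_eq] at hd1 hd2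
  have hd3 := abs_lt.1 hd1
  have hsmall : ‖((y - τ : ℝ) : ℂ) • α τ‖ < ε / 2 := by
    rw [norm_smul, Complex.norm_real, Real.norm_eq_abs]
    calc |y - τ| * ‖α τ‖ ≤ |y - τ| * (‖α τ‖ + 1) := by gcongr; linarith
      _ < ε / (2 * (‖α τ‖ + 1)) * (‖α τ‖ + 1) := by gcongr
      _ = ε / 2 := by field_simp
  have hdef : ‖((y - τ : ℝ) : ℂ) • α τ - (c y - c τ)‖ ≤ ε / 2 := by
    rcases le_total τ y with h | h
    · exact H τ τ y hτ.1 le_rfl h hy.2 (by linarith [hδ τ]) (by linarith)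
    · have := H τ y τ hy.1 h le_rfl hτ.2 (by linarith) (by linarith [hδ τ])
      rw [← norm_neg]
      refine le_of_eq_of_le (congrArg norm ?_) this
      rw [blockDefect, riemannTerm, smul_eq_mul, smul_eq_mul]
      push_cast
      ring
  rw [dist_eq_norm]
  have h3 : c y - c τ = ((y - τ : ℝ) : ℂ) • α τ - (((y - τ : ℝ) : ℂ) • α τ - (c y - c τ)) := by
    abel
  rw [h3]
  exact (norm_sub_le _ _).trans_lt (by linarith)

/-- The fundamental theorem of (hc : ∀ t ∈ Set.Icc a b, HasHKIntegral α a t (c t))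
    calculus for `F ∘ c`, where `c` is an indefinite Henstock–Kurzweil
integral. -/
theorem hasHKIntegral_comp_mul (hc : ∀ t ∈ Set.Icc a b, HasHKIntegral α a t (c t))
    (hab : a ≤ b) {F f : ℂ → ℂ} (hF : ∀ z, HasStrictDerivAt F (f z) z)
    (hf : Continuous f) {t : ℝ} (ht : t ∈ Set.Icc a b) :
    HasHKIntegral (fun s => f (c s) * α s) a t (F (c t) - F (c a)) := by
  rw [hasHKIntegral_iff]
  intro ε hε
  have hcont : ContinuousOn c (Set.Icc a t) :=
    (continuousOn_indefinite hc hab).mono (Set.Icc_subset_Icc le_rfl ht.2)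
  obtain ⟨M, hM⟩ := isCompact_Icc.exists_bound_of_continuousOn (hf.comp_continuousOn hcont)
  have hM0 : 0 ≤ M := (norm_nonneg _).trans (hM a ⟨le_rfl, ht.1⟩)
  -- `t - a` pays for the telescoping part of the error, `1 + M` for the total defect, and the final
  -- `1` makes the estimate strict.
  set C : ℝ := (t - a) + (1 + M) + 1 with hC
  have hC0 : 0 < C := by linarith [ht.1]
  obtain ⟨κ, hκ0, hκ1, hκε⟩ : ∃ κ : ℝ, 0 < κ ∧ κ ≤ 1 ∧ κ * C ≤ ε :=
    ⟨min 1 (ε / C), lt_min one_pos (div_pos hε hC0), min_le_left _ _, by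
      calc min 1 (ε / C) * C ≤ ε / C * C := by gcongr; exact min_le_right _ _
        _ = ε := by field_simp⟩
  obtain ⟨δ, hδ, H⟩ := saks_henstock hc hab ht hκ0
  -- Strict differentiability is needed because neither block end need be the tag. The factor `1 /
  -- (1 + ‖α τ‖)` compensates for `‖c y - c x‖` being of size `(y - x) * ‖α τ‖` up to the defect.
  have hρ : ∀ τ, ∃ ρ > 0, τ ∈ Set.Icc a t → ∀ x ∈ Set.Icc a t, ∀ y ∈ Set.Icc a t,
      |x - τ| < ρ → |y - τ| < ρ →
      ‖F (c y) - F (c x) - f (c τ) * (c y - c x)‖ ≤ κ / (1 + ‖α τ‖) * ‖c y - c x‖ := by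
    intro τ
    by_cases hτ : τ ∈ Set.Icc a t
    swap
    · exact ⟨1, one_pos, fun h => absurd h hτ⟩
    have h1 := (hF (c τ)).isLittleO.def (show 0 < κ / (1 + ‖α τ‖) by positivity)
    rw [nhds_prod_eq] at h1
    have h2 := (Filter.Tendsto.prodMap (hcont τ hτ) (hcont τ hτ)).eventually h1
    obtain ⟨V, hV, h3⟩ := Filter.eventually_prod_self_iff'.1 h2
    obtain ⟨ρ, hρ, hball⟩ := Metric.mem_nhdsWithin_iff.1 hV
    refine ⟨ρ, hρ, fun _ x hx y hy hxρ hyρ => ?_⟩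
    have h4 := h3 y (hball ⟨hyρ, hy⟩) x (hball ⟨hxρ, hx⟩)
    simpa [mul_comm] using h4
  choose ρ hρ0 hρ using hρ
  refine ⟨fun s => min (δ s) (ρ s), fun s => lt_min (hδ s) (hρ0 s), fun P hP => ?_⟩
  have hSH := H P (hP.mono fun s => min_le_left (δ s) (ρ s))
  rw [← tagSum_telescope (fun s => F (c s)) hP, ← tagSum_sub]
  have hterm : ∀ τ x y, a ≤ x → x ≤ τ → τ ≤ y → y ≤ t → τ - min (δ τ) (ρ τ) < x →
      y < τ + min (δ τ) (ρ τ) →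
      ‖riemannTerm (fun s => f (c s) * α s) τ x y - (F (c y) - F (c x))‖ ≤
        (κ * y - κ * x) + (1 + M) * ‖blockDefect α c τ x y‖ := by
    intro τ x y hax hxτ hτy hyt h1 h2
    have hρ' := min_le_right (δ τ) (ρ τ)
    have hτ : τ ∈ Set.Icc a t := ⟨hax.trans hxτ, hτy.trans hyt⟩
    have hd := hρ τ hτ x ⟨hax, hxτ.trans hτ.2⟩ y ⟨hτ.1.trans hτy, hyt⟩
      (abs_lt.2 ⟨by linarith, by linarith [hρ0 τ]⟩) (abs_lt.2 ⟨by linarith [hρ0 τ], by linarith⟩)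
    have hpos : 0 < 1 + ‖α τ‖ := by positivity
    have hxy : 0 ≤ y - x := by linarith
    have hcd : ‖c y - c x‖ ≤ (y - x) * ‖α τ‖ + ‖blockDefect α c τ x y‖ := by
      have h3 : c y - c x = riemannTerm α τ x y - blockDefect α c τ x y := by
        simp [blockDefect]
      have h4 : ‖riemannTerm α τ x y‖ = (y - x) * ‖α τ‖ := by
        rw [riemannTerm, norm_smul, Complex.norm_real, Real.norm_eq_abs, abs_of_nonneg hxy]
      rw [h3, ← h4]
      exact norm_sub_le _ _
    have hκ' : κ / (1 + ‖α τ‖) * ‖c y - c x‖ ≤ κ * (y - x) + ‖blockDefect α c τ x y‖ := by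
      rw [div_mul_eq_mul_div, div_le_iff₀ hpos]
      have h5 := norm_nonneg (blockDefect α c τ x y)
      have h6 := norm_nonneg (α τ)
      calc κ * ‖c y - c x‖ ≤ κ * ((y - x) * ‖α τ‖ + ‖blockDefect α c τ x y‖) := by gcongr
        _ ≤ κ * (y - x) * (1 + ‖α τ‖) + ‖blockDefect α c τ x y‖ * (1 + ‖α τ‖) := by
            have h7 : 0 ≤ κ * (y - x) := by positivity
            have h8 : κ * ‖blockDefect α c τ x y‖ ≤ 1 * ‖blockDefect α c τ x y‖ := by gcongr
            have h9 : 0 ≤ ‖blockDefect α c τ x y‖ * ‖α τ‖ := by positivity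
            linarith
        _ = _ := by ring
    have heq : riemannTerm (fun s => f (c s) * α s) τ x y - (F (c y) - F (c x)) =
        f (c τ) * blockDefect α c τ x y
          - (F (c y) - F (c x) - f (c τ) * (c y - c x)) := by
      rw [blockDefect, riemannTerm, riemannTerm, smul_eq_mul, smul_eq_mul]
      ring
    rw [heq]
    calc _ ≤ ‖f (c τ) * blockDefect α c τ x y‖ +
          ‖F (c y) - F (c x) - f (c τ) * (c y - c x)‖ := norm_sub_le _ _
      _ ≤ M * ‖blockDefect α c τ x y‖ + (κ * (y - x) + ‖blockDefect α c τ x y‖) := by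
          rw [norm_mul]
          gcongr
          · exact hM τ hτ
          · exact hd.trans hκ'
      _ = _ := by ring
  calc _ ≤ _ := norm_tagSum_le _ _ _
    _ ≤ _ := tagSum_le (a := a) hterm le_rfl hP
    _ = (κ * t - κ * a) + (1 + M) * tagSum (fun τ x y => ‖blockDefect α c τ x y‖) a P := by
        rw [tagSum_add, tagSum_telescope (fun s => κ * s) hP]
        congr 1
        exact (map_tagSum (AddMonoidHom.mulLeft (1 + M)) _ P a).symm
    _ ≤ (κ * t - κ * a) + (1 + M) * κ := by gcongr
    _ < κ * C := by rw [hC]; linarith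
    _ ≤ ε := hκε

/-- The integral of `c ^ k / k! * α` is `c ^ (k + 1) / (k + 1)!`. -/
theorem hasHKIntegral_pow_div_factorial (hc : ∀ t ∈ Set.Icc a b, HasHKIntegral α a t (c t))
    (hab : a ≤ b) (k : ℕ) {t : ℝ} (ht : t ∈ Set.Icc a b) :
    HasHKIntegral (fun s => c s ^ k / (k.factorial : ℂ) * α s) a t
      (c t ^ (k + 1) / ((k + 1).factorial : ℂ)) := by
  have h := hasHKIntegral_comp_mul hc hab (F := fun z => z ^ (k + 1) / ((k + 1).factorial : ℂ))
    (f := fun z => z ^ k / (k.factorial : ℂ)) (fun z => ?_) (by fun_prop) ht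
  · simpa [indefinite_start hc hab] using h
  · refine ((hasStrictDerivAt_pow (k + 1) z).div_const ((k + 1).factorial : ℂ)).congr_deriv ?_
    have h1 : (k.factorial : ℂ) ≠ 0 := Nat.cast_ne_zero.2 k.factorial_ne_zero
    have h2 : (k : ℂ) + 1 ≠ 0 := Nat.cast_add_one_ne_zero k
    rw [Nat.factorial_succ]
    push_cast
    field_simp

end Indefinite

/-! ### Semigroups and their generators -/

section Semigroup

variable {E : Type*} [NormedAddCommGroup E] [NormedSpace ℂ E]
variable {Q : E →ₗ.[ℂ] E} {S : ℝ → E →L[ℂ] E}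

theorem IsPow.unique : ∀ {k : ℕ} {x y y' : E}, IsPow Q k x y → IsPow Q k x y' → y = y'
  | 0, _, _, _, h, h' => h.trans h'.symm
  | _ + 1, _, _, _, ⟨_, hz, h⟩, ⟨_, hz', h'⟩ => by
    cases hz.unique hz'
    exact Q.mem_graph_snd_inj h h' rfl

/-- The vectors `Q ^ k x`, `k ≤ n`, for `x` in the domain of `Q ^ n`. -/
theorem IsPow.exists_chain : ∀ {n : ℕ} {x y : E}, IsPow Q n x y →
    ∃ z : ℕ → E, z 0 = x ∧ ∀ k < n, (z k, z (k + 1)) ∈ Q.graph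
  | 0, x, _, _ => ⟨fun _ => x, rfl, by simp⟩
  | n + 1, x, y, ⟨w, hw, h⟩ => by
    obtain ⟨z, hz0, hz⟩ := hw.exists_chain
    have hpow : ∀ k ≤ n, IsPow Q k x (z k) := by
      intro k
      induction k with
      | zero => exact fun _ => hz0
      | succ k ih => exact fun hk => ⟨z k, ih (by omega), hz k (by omega)⟩
    have hzn : z n = w := (hpow n le_rfl).unique hw
    refine ⟨Function.update z (n + 1) y, by simpa using hz0, fun k hk => ?_⟩
    rw [Function.update_of_ne (by omega)]
    rcases Nat.lt_succ_iff_lt_or_eq.1 hk with hk | rfl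
    · rw [Function.update_of_ne (by omega)]
      exact hz k hk
    · rw [Function.update_self, hzn]
      exact h

theorem IsC0Semigroup.commute (hS : IsC0Semigroup S) {s t : ℝ} (hs : 0 ≤ s) (ht : 0 ≤ t) (x : E) :
    S s (S t x) = S t (S s x) := by
  have h1 := hS.add s t hs ht
  rw [add_comm, hS.add t s ht hs] at h1
  exact (DFunLike.congr_fun h1 x).symm

/-- `S t` is continuous and commutes with the difference quotients at zero. -/
theorem IsGeneratorOf.map_mem (hS : IsC0Semigroup S) (hQ : IsGeneratorOf Q S) {x y : E}
    (h : (x, y) ∈ Q.graph) {t : ℝ} (ht : 0 ≤ t) : (S t x, S t y) ∈ Q.graph := by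
  rw [hQ] at h ⊢
  refine (((S t).continuous.tendsto y).comp h).congr' ?_
  filter_upwards [self_mem_nhdsWithin] with r hr
  rw [Function.comp_apply, map_smul, map_sub, hS.commute ht (le_of_lt hr)]

variable [NormedSpace ℝ E]

theorem IsC0Semigroup.continuousOn_taylor_remainder (hS : IsC0Semigroup S) (w : ℝ) (n : ℕ) (x : E) :
    ContinuousOn (fun ξ => ((w - ξ) ^ n / (n.factorial : ℝ)) • S ξ x) (Set.Ici 0) :=
  ContinuousOn.smul (f := fun ξ : ℝ => (w - ξ) ^ n / (n.factorial : ℝ)) (by fun_prop) (hS.cont x)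

variable [IsScalarTower ℝ ℂ E]

theorem ofReal_smul (r : ℝ) (x : E) : (r : ℂ) • x = r • x := algebraMap_smul ℂ r x

theorem IsGeneratorOf.hasDerivWithinAt (hS : IsC0Semigroup S) (hQ : IsGeneratorOf Q S) {x y : E}
    (h : (x, y) ∈ Q.graph) {t : ℝ} (ht : 0 ≤ t) :
    HasDerivWithinAt (fun s => S s x) (S t y) (Set.Ioi t) t := by
  rw [hasDerivWithinAt_iff_tendsto_slope' (by simp)]
  have h1 := (hQ _ _).1 (hQ.map_mem hS h ht)
  have h2 : Tendsto (fun s : ℝ => s - t) (𝓝[>] t) (𝓝[>] 0) := by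
    refine tendsto_nhdsWithin_iff.2 ⟨?_, ?_⟩
    · exact ((continuous_id.sub continuous_const).tendsto' t 0 (by simp)).mono_left
        nhdsWithin_le_nhds
    · filter_upwards [self_mem_nhdsWithin] with s hs using sub_pos.2 (Set.mem_Ioi.1 hs)
  refine (h1.comp h2).congr' ?_
  filter_upwards [self_mem_nhdsWithin] with s hs
  have hs' : 0 ≤ s - t := (sub_pos.2 (Set.mem_Ioi.1 hs)).le
  have h3 : S s x = S (s - t) (S t x) := by
    rw [← ContinuousLinearMap.comp_apply, ← hS.add _ _ hs' ht, sub_add_cancel]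
  rw [Function.comp_apply, slope, vsub_eq_sub, h3, ← Complex.ofReal_inv]
  exact ofReal_smul _ _

/-- The derivative of the Taylor polynomial of the orbit, expanded at a moving base point. -/
theorem IsGeneratorOf.hasDerivWithinAt_taylor (hS : IsC0Semigroup S) (hQ : IsGeneratorOf Q S)
    (w : ℝ) {ξ : ℝ} (hξ : 0 ≤ ξ) {z : ℕ → E} : ∀ n : ℕ, (∀ k < n + 1, (z k, z (k + 1)) ∈ Q.graph) →
    HasDerivWithinAt
      (fun ξ => ∑ k ∈ Finset.range (n + 1), ((w - ξ) ^ k / (k.factorial : ℝ)) • S ξ (z k))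
      (((w - ξ) ^ n / (n.factorial : ℝ)) • S ξ (z (n + 1))) (Set.Ioi ξ) ξ
  | 0, h => by
    simpa using hQ.hasDerivWithinAt hS (h 0 (by omega)) hξ
  | n + 1, h => by
    have ih := hQ.hasDerivWithinAt_taylor hS w hξ n fun k hk => h k (by omega)
    have h1 : HasDerivAt (fun ξ : ℝ => (w - ξ) ^ (n + 1) / ((n + 1).factorial : ℝ))
        (-((w - ξ) ^ n / (n.factorial : ℝ))) ξ := by
      refine ((((hasDerivAt_id ξ).const_sub w).pow (n + 1)).div_const
        ((n + 1).factorial : ℝ)).congr_deriv ?_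
      have h1 : (n.factorial : ℝ) ≠ 0 := Nat.cast_ne_zero.2 n.factorial_ne_zero
      have h2 : (n : ℝ) + 1 ≠ 0 := Nat.cast_add_one_ne_zero n
      rw [Nat.factorial_succ]
      push_cast
      field_simp
      simp
    -- Differentiating the new coefficient cancels the derivative from the previous order, leaving
    -- only the new top term.
    have h2 := ih.add (h1.hasDerivWithinAt.smul
      (hQ.hasDerivWithinAt hS (h (n + 1) (by omega)) hξ))
    simp only [Finset.sum_range_succ _ (n + 1)]
    refine h2.congr_deriv ?_
    module

/-- Taylor's formula with integral remainder for the orbit of a semigroup. -/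
theorem IsGeneratorOf.taylor [CompleteSpace E] (hS : IsC0Semigroup S) (hQ : IsGeneratorOf Q S)
    {w : ℝ} (hw : 0 ≤ w) (n : ℕ) {z : ℕ → E} (hz : ∀ k < n + 1, (z k, z (k + 1)) ∈ Q.graph) :
    ∫ ξ in (0 : ℝ)..w, ((w - ξ) ^ n / (n.factorial : ℝ)) • S ξ (z (n + 1)) =
      S w (z 0) - ∑ k ∈ Finset.range (n + 1), (w ^ k / (k.factorial : ℝ)) • z k := by
  have hsub : Set.Icc 0 w ⊆ Set.Ici 0 := fun ξ hξ => hξ.1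
  rw [intervalIntegral.integral_eq_sub_of_hasDeriv_right_of_le hw
    (f := fun ξ => ∑ k ∈ Finset.range (n + 1), ((w - ξ) ^ k / (k.factorial : ℝ)) • S ξ (z k))]
  · rw [Finset.sum_range_succ', hS.zero]
    simp
  · exact continuousOn_finsetSum _ fun k _ =>
      (hS.continuousOn_taylor_remainder w k (z k)).mono hsub
  · exact fun ξ hξ => hQ.hasDerivWithinAt_taylor hS w hξ.1.le n hz
  · refine ContinuousOn.intervalIntegrable ?_
    rw [Set.uIcc_of_le hw]
    exact (hS.continuousOn_taylor_remainder w n _).mono hsub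

/-- In Taylor's remainder, compare `S ξ` with its value at `ξ = 0`. Strong continuity at zero makes
the difference `o(w ^ (n + 1))`. -/
theorem IsGeneratorOf.isPoincareAsymptotic [CompleteSpace E] (hS : IsC0Semigroup S)
    (hQ : IsGeneratorOf Q S) : IsPoincareAsymptotic Q S := by
  intro n Φ y hy
  have hchain : ∀ k < n + 1, (y k, y (k + 1)) ∈ Q.graph := by
    intro k hk
    obtain ⟨z, hz, h⟩ := hy (k + 1) (by omega)
    rwa [(hy k (by omega)).unique hz]
  have hy0 : y 0 = Φ := hy 0 (by omega)
  rw [Metric.tendsto_nhdsWithin_nhds]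
  intro ε hε
  obtain ⟨δ, hδ, hball⟩ := Metric.continuousWithinAt_iff.1
    (hS.cont (y (n + 1)) 0 Set.self_mem_Ici) (ε / 2) (half_pos hε)
  refine ⟨δ, hδ, fun w hw hwδ => ?_⟩
  have hw0 : 0 < w := hw
  rw [Real.dist_eq, sub_zero, abs_of_pos hw0] at hwδ
  have hsum : ∀ k, ((w : ℂ) ^ k / (k.factorial : ℂ)) • y k
      = (w ^ k / (k.factorial : ℝ)) • y k := by
    intro k
    rw [← ofReal_smul]
    push_cast
    rfl
  have hint : ∫ ξ in (0 : ℝ)..w, ((w - ξ) ^ n / (n.factorial : ℝ)) • y (n + 1) =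
      (w ^ (n + 1) / ((n + 1).factorial : ℝ)) • y (n + 1) := by
    rw [intervalIntegral.integral_smul_const, intervalIntegral.integral_div,
      intervalIntegral.integral_comp_sub_left (fun s => s ^ n), integral_pow, Nat.factorial_succ]
    congr 1
    push_cast
    simp [div_div]
  have hsub : Set.uIcc 0 w ⊆ Set.Ici 0 := by
    rw [Set.uIcc_of_le hw0.le]; exact fun ξ hξ => hξ.1
  have hnorm : ‖∫ ξ in (0 : ℝ)..w, (((w - ξ) ^ n / (n.factorial : ℝ)) • S ξ (y (n + 1)) -
      ((w - ξ) ^ n / (n.factorial : ℝ)) • y (n + 1))‖ ≤ w ^ n * (ε / 2) * |w - 0| := by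
    refine intervalIntegral.norm_integral_le_of_norm_le_const fun ξ hξ => ?_
    rw [Set.uIoc_of_le hw0.le] at hξ
    rw [← smul_sub, norm_smul, Real.norm_eq_abs]
    have h1 : 0 ≤ w - ξ := by linarith [hξ.2]
    rw [abs_of_nonneg (by positivity)]
    have h2 : ‖S ξ (y (n + 1)) - y (n + 1)‖ ≤ ε / 2 := by
      have := hball (x := ξ) hξ.1.le (by
        rw [Real.dist_eq, sub_zero, abs_of_pos hξ.1]; linarith [hξ.2])
      rw [dist_eq_norm, hS.zero] at this
      exact this.le
    have h3 : (w - ξ) ^ n / (n.factorial : ℝ) ≤ w ^ n :=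
      (div_le_self (by positivity) (Nat.one_le_cast.2 n.factorial_pos)).trans
        (pow_le_pow_left₀ h1 (by linarith [hξ.1]) n)
    gcongr
  rw [intervalIntegral.integral_sub
      (((hS.continuousOn_taylor_remainder w n _).mono hsub).intervalIntegrable)
      (Continuous.intervalIntegrable (by fun_prop) _ _), hint, hQ.taylor hS hw0.le n hchain,
    sub_zero, abs_of_pos hw0, hy0] at hnorm
  simp only [hsum]
  rw [dist_eq_norm]
  set T := S w Φ - ∑ k ∈ Finset.range (n + 1), (w ^ k / (k.factorial : ℝ)) • y k
  clear_value T
  have heq : ((w : ℂ) ^ (n + 1))⁻¹ • T - ((n + 1).factorial : ℂ)⁻¹ • y (n + 1) =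
      ((w : ℂ) ^ (n + 1))⁻¹ • (T - (w ^ (n + 1) / ((n + 1).factorial : ℝ)) • y (n + 1)) := by
    have hwc : ((w : ℂ) ^ (n + 1)) ≠ 0 := pow_ne_zero _ (Complex.ofReal_ne_zero.2 hw0.ne')
    rw [smul_sub, ← ofReal_smul (w ^ (n + 1) / ((n + 1).factorial : ℝ)), smul_smul]
    congr 2
    push_cast
    field_simp
  rw [heq, norm_smul, norm_inv, norm_pow, Complex.norm_real, Real.norm_eq_abs, abs_of_pos hw0,
    inv_mul_lt_iff₀ (by positivity)]
  calc _ ≤ _ := hnorm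
    _ = w ^ (n + 1) * (ε / 2) := by ring
    _ < w ^ (n + 1) * ε := by gcongr; linarith

/-- The domain of the generator of a `C₀`-semigroup is dense. -/
theorem IsGeneratorOf.dense_domain [CompleteSpace E] (hS : IsC0Semigroup S)
    (hQ : IsGeneratorOf Q S) : Dense (Q.domain : Set E) := by
  intro x
  -- Freezing the orbit for negative times makes it continuous on the whole line; its averages over
  -- `[0, r]` lie in the domain and tend to `x`.
  set f : ℝ → E := fun s => S (max s 0) x with hf
  have hfc : Continuous f := by
    have := (hS.cont x).comp_continuous (f := fun s : ℝ => max s 0) (by fun_prop)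
      fun s => Set.mem_Ici.2 (le_max_right _ _)
    exact this
  set F : ℝ → E := fun r => ∫ s in (0 : ℝ)..r, f s with hF
  have hFd : ∀ r, HasDerivAt F (f r) r := fun r =>
    intervalIntegral.integral_hasDerivAt_right (hfc.intervalIntegrable _ _)
      (hfc.stronglyMeasurableAtFilter _ _) hfc.continuousAt
  have hf0 : f 0 = x := by simp [hf, hS.zero]
  have hF0 : F 0 = 0 := by simp [hF]
  have hmem : ∀ r, 0 < r → F r ∈ Q.domain := by
    intro r hr
    have hg : (F r, f r - f 0) ∈ Q.graph := by
      rw [hQ]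
      have h1 := (hFd r).tendsto_slope_zero_right
      have h2 := (hFd 0).tendsto_slope_zero_right
      refine (h1.sub h2).congr' ?_
      filter_upwards [self_mem_nhdsWithin] with h hh
      have hh0 : (0 : ℝ) ≤ h := le_of_lt hh
      -- So `S h (F r) - F r` is the difference of the increments of `F` at `r` and at `0`.
      have h3 : S h (F r) = F (r + h) - F h := by
        have : S h (F r) = ∫ s in (0 : ℝ)..r, f (s + h) := by
          rw [hF, ← ContinuousLinearMap.intervalIntegral_comp_comm _
            (hfc.intervalIntegrable _ _)]
          refine intervalIntegral.integral_congr fun s hs => ?_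
          rw [Set.uIcc_of_le hr.le] at hs
          simp only [hf]
          rw [max_eq_left hs.1, max_eq_left (by linarith [hs.1]), add_comm,
            hS.add h s hh0 hs.1, ContinuousLinearMap.comp_apply]
        rw [this, intervalIntegral.integral_comp_add_right, zero_add, hF]
        exact (intervalIntegral.integral_interval_sub_left (hfc.intervalIntegrable _ _)
          (hfc.intervalIntegrable _ _)).symm
      rw [h3, ← smul_sub, ← Complex.ofReal_inv, ofReal_smul, hF0, zero_add, sub_zero]
      congr 1
      abel
    exact LinearPMap.mem_domain_of_mem_graph hg
  have hlim : Tendsto (fun r : ℝ => r⁻¹ • F r) (𝓝[>] 0) (𝓝 x) := by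
    have := (hFd 0).tendsto_slope_zero_right
    simpa [hF0, hf0] using this
  refine mem_closure_of_tendsto hlim ?_
  filter_upwards [self_mem_nhdsWithin] with r hr
  rw [← ofReal_smul]
  exact Q.domain.smul_mem _ (hmem r hr)

end Semigroup

/-! ### Iterated integrals -/

section Iterated

variable {E : Type*} [NormedAddCommGroup E] [NormedSpace ℂ E] {a b : ℝ}

/-- Inductively, two choices of the inner integral agree off the union of their countable
exceptional sets, which the outer integral ignores. -/
theorem HasIteratedIntegral.unique : ∀ {k : ℕ} {t : Set.Icc a b}
    {F : List (Set.Icc a b) → E → Prop} {v v' : E},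
    (∀ l u u', F l u → F l u' → u = u') →
    HasIteratedIntegral k t F v → HasIteratedIntegral k t F v' → v = v'
  | 0, _, _, _, _, hF, h, h' => hF _ _ _ h h'
  | k + 1, t, F, v, v', hF, ⟨G, ⟨N, hN, hG⟩, hv⟩, ⟨G', ⟨N', hN', hG'⟩, hv'⟩ => by
    refine (hv.congr ((hN.union hN').image Subtype.val) fun s hs hsN => ?_).unique t.2.1 hv'
    set σ : Set.Icc a b := ⟨s, hs.1, hs.2.trans t.2.2⟩
    have hσ : σ ∉ N ∪ N' := fun h => hsN ⟨σ, h, rfl⟩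
    rw [Set.mem_union, not_or] at hσ
    exact HasIteratedIntegral.unique (fun l => hF (σ :: l)) (hG σ hs.2 hσ.1) (hG' σ hs.2 hσ.2)

theorem HasIteratedIntegral.add : ∀ {k : ℕ} {t : Set.Icc a b}
    {F F₁ F₂ : List (Set.Icc a b) → E → Prop} {v v' : E},
    (∀ l u u', F₁ l u → F₂ l u' → F l (u + u')) →
    HasIteratedIntegral k t F₁ v → HasIteratedIntegral k t F₂ v' →
    HasIteratedIntegral k t F (v + v')
  | 0, _, _, _, _, _, _, hF, h, h' => hF _ _ _ h h'
  | k + 1, t, F, _, _, v, v', hF, ⟨G, ⟨N, hN, hG⟩, hv⟩, ⟨G', ⟨N', hN', hG'⟩, hv'⟩ => by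
    refine ⟨fun s => G s + G' s, ⟨N ∪ N', hN.union hN', fun s hs hsN => ?_⟩, hv.add hv'⟩
    rw [Set.mem_union, not_or] at hsN
    exact HasIteratedIntegral.add (fun l => hF (s :: l)) (hG s hs hsN.1) (hG' s hs hsN.2)

theorem HasIteratedIntegral.const_smul (z : ℂ) : ∀ {k : ℕ} {t : Set.Icc a b}
    {F F₁ : List (Set.Icc a b) → E → Prop} {v : E}, (∀ l u, F₁ l u → F l (z • u)) →
    HasIteratedIntegral k t F₁ v → HasIteratedIntegral k t F (z • v)
  | 0, _, _, _, _, hF, h => hF _ _ h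
  | _ + 1, _, _, _, _, hF, ⟨G, ⟨N, hN, hG⟩, hv⟩ =>
    ⟨fun s => z • G s, ⟨N, hN, fun s hs hsN =>
      HasIteratedIntegral.const_smul z (fun l => hF (s :: l)) (hG s hs hsN)⟩, hv.const_smul z⟩

theorem hasIteratedIntegral_zero : ∀ {k : ℕ} {t : Set.Icc a b}
    {F : List (Set.Icc a b) → E → Prop}, (∀ l, F l 0) → HasIteratedIntegral k t F 0
  | 0, _, _, hF => hF []
  | _ + 1, _, _, hF => ⟨fun _ => 0, ⟨∅, Set.countable_empty, fun s _ _ =>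
      hasIteratedIntegral_zero fun l => hF (s :: l)⟩,
      hasHKIntegral_zero_of_countable Set.countable_empty fun _ _ _ => rfl⟩

end Iterated

/-! ### Time-ordered operators -/

section Film

variable {H : Type*} [NormedAddCommGroup H] [InnerProductSpace ℂ H]
variable {ι : Type*} {a b : ℝ}

namespace FilmIndex

variable (p : FilmIndex a b ι) (s t : Set.Icc a b) (j k : ι)

@[simp] theorem update_base : (p.update s k).base = p.base := rfl

@[simp] theorem update_val_self : (p.update s k).val s = k := Function.update_self ..

variable {s t} in
theorem update_val_of_ne (h : t ≠ s) : (p.update s k).val t = p.val t :=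
  Function.update_of_ne h ..

@[simp] theorem update_update : (p.update s j).update s k = p.update s k := by
  ext1 <;> simp [update]

variable {s t} in
theorem update_comm (h : s ≠ t) : (p.update s j).update t k = (p.update t k).update s j := by
  ext1
  · rfl
  · exact Function.update_comm h ..

variable {p s k} in
theorem update_eq_self (h : p.val s = k) : p.update s k = p := by
  subst h
  ext1
  · rfl
  · exact Function.update_eq_self ..

end FilmIndex

section Operators

variable {e : HilbertBasis ι ℂ H} {A : Set.Icc a b → H →ₗ.[ℂ] H} {T : H →ₗ.[ℂ] H}
  {t : Set.Icc a b} {Φ Φ' Ψ Ψ' : FDSpace a b ι}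

theorem TimeOrderedOp.unique (h : TimeOrderedOp e T t Φ Ψ) (h' : TimeOrderedOp e T t Φ Ψ') :
    Ψ = Ψ' := by
  ext p
  obtain ⟨x, hx, hTx⟩ := h p
  obtain ⟨x', hx', hTx'⟩ := h' p
  have hxx : x = x' := Subtype.ext (e.repr.injective (lp.ext (funext fun k => by rw [hx, hx'])))
  rw [← FilmIndex.update_eq_self (p := p) (s := t) rfl, ← hTx, ← hTx', hxx]

theorem TimeOrderedOp.add (h : TimeOrderedOp e T t Φ Ψ) (h' : TimeOrderedOp e T t Φ' Ψ') :
    TimeOrderedOp e T t (Φ + Φ') (Ψ + Ψ') := by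
  intro p
  obtain ⟨x, hx, hTx⟩ := h p
  obtain ⟨x', hx', hTx'⟩ := h' p
  refine ⟨x + x', fun k => ?_, fun k => ?_⟩
  · simp [hx, hx']
  · simp [T.map_add, hTx, hTx']

theorem TimeOrderedOp.const_smul (z : ℂ) (h : TimeOrderedOp e T t Φ Ψ) :
    TimeOrderedOp e T t (z • Φ) (z • Ψ) := by
  intro p
  obtain ⟨x, hx, hTx⟩ := h p
  refine ⟨z • x, fun k => ?_, fun k => ?_⟩
  · simp [hx]
  · simp [T.map_smul, hTx]

theorem timeOrderedOp_zero : TimeOrderedOp e T t (0 : FDSpace a b ι) 0 :=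
  fun _ => ⟨0, by simp, by simp⟩

theorem TimeOrderedProd.unique : ∀ (l : List (Set.Icc a b)) (Ψ Ψ' : FDSpace a b ι),
    TimeOrderedProd e A Φ l Ψ → TimeOrderedProd e A Φ l Ψ' → Ψ = Ψ'
  | [], _, _, h, h' => h.trans h'.symm
  | _ :: l, _, _, ⟨_, h₁, h₂⟩, ⟨_, h₁', h₂'⟩ => by
    cases TimeOrderedProd.unique l _ _ h₁ h₁'
    exact h₂.unique h₂'

theorem TimeOrderedProd.add : ∀ (l : List (Set.Icc a b)) (Ψ Ψ' : FDSpace a b ι),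
    TimeOrderedProd e A Φ l Ψ → TimeOrderedProd e A Φ' l Ψ' →
      TimeOrderedProd e A (Φ + Φ') l (Ψ + Ψ')
  | [], _, _, h, h' => congrArg₂ (· + ·) h h'
  | _ :: l, _, _, ⟨_, h₁, h₂⟩, ⟨_, h₁', h₂'⟩ =>
    ⟨_, TimeOrderedProd.add l _ _ h₁ h₁', h₂.add h₂'⟩

theorem TimeOrderedProd.const_smul (z : ℂ) : ∀ (l : List (Set.Icc a b)) (Ψ : FDSpace a b ι),
    TimeOrderedProd e A Φ l Ψ → TimeOrderedProd e A (z • Φ) l (z • Ψ)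
  | [], _, h => congrArg (z • ·) h
  | _ :: l, _, ⟨_, h₁, h₂⟩ => ⟨_, TimeOrderedProd.const_smul z l _ h₁, h₂.const_smul z⟩

theorem timeOrderedProd_zero : ∀ l : List (Set.Icc a b),
    TimeOrderedProd e A (0 : FDSpace a b ι) l 0
  | [] => rfl
  | _ :: l => ⟨0, timeOrderedProd_zero l, timeOrderedOp_zero⟩

end Operators

/-! ### Vectors that are constant in most time slots -/

/-- `Φ` carries the basis vector `e i` in slot `s`. -/
def IsPureAt (i : ι) (s : Set.Icc a b) (Φ : FDSpace a b ι) : Prop :=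
  ∀ p : FilmIndex a b ι, p.val s ≠ i → Φ p = 0

/-- The squared coordinates sample the summable double family `‖x_k‖² ‖Φ_q‖²` along an injective
map: `p` is recovered by writing its entry at `s` back into `p.update s i`. -/
theorem memℓp_insertSlot (e : HilbertBasis ι ℂ H) (i : ι) (s : Set.Icc a b) (x : H)
    (Φ : FDSpace a b ι) :
    Memℓp (fun p : FilmIndex a b ι => e.repr x (p.val s) * Φ (p.update s i)) 2 := by
  have h2 : 0 < (2 : ENNReal).toReal := by norm_num
  have hx := (lp.memℓp (e.repr x)).summable h2
  have hΦ := (lp.memℓp Φ).summable h2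
  have hprod := hx.mul_of_nonneg hΦ (fun _ => by positivity) (fun _ => by positivity)
  have hinj : Function.Injective fun p : FilmIndex a b ι => (p.val s, p.update s i) := by
    intro p q hpq
    have h1 : p.val s = q.val s := congrArg Prod.fst hpq
    have h3 : p.update s i = q.update s i := congrArg Prod.snd hpq
    have h4 := congrArg (fun r => FilmIndex.update r s (p.val s)) h3
    simp only [FilmIndex.update_update] at h4
    rwa [FilmIndex.update_eq_self rfl, FilmIndex.update_eq_self h1.symm] at h4
  refine (memℓp_gen_iff h2).2 ((hprod.comp_injective hinj).congr fun p => ?_)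
  rw [Function.comp_apply, norm_mul, Real.mul_rpow (norm_nonneg _) (norm_nonneg _)]

/-- Replace the basis vector `e i` in slot `s` by the vector `x`. -/
def insertSlot (e : HilbertBasis ι ℂ H) (i : ι) (s : Set.Icc a b) (x : H) (Φ : FDSpace a b ι) :
    FDSpace a b ι :=
  ⟨fun p => e.repr x (p.val s) * Φ (p.update s i), memℓp_insertSlot e i s x Φ⟩

section Insert

variable {e : HilbertBasis ι ℂ H} {i : ι} {s t : Set.Icc a b} {Φ : FDSpace a b ι}

theorem insertSlot_apply (x : H) (p : FilmIndex a b ι) :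
    insertSlot e i s x Φ p = e.repr x (p.val s) * Φ (p.update s i) := rfl

theorem repr_basis_self : e.repr (e i) i = 1 := by
  classical
  rw [e.repr_self]; simp

theorem repr_basis_of_ne {k : ι} (h : k ≠ i) : e.repr (e i) k = 0 := by
  classical
  rw [e.repr_self]; simp [h]

theorem insertSlot_comm (h : s ≠ t) (x y : H) :
    insertSlot e i s x (insertSlot e i t y Φ) = insertSlot e i t y (insertSlot e i s x Φ) := by
  ext p
  simp only [insertSlot_apply]
  rw [FilmIndex.update_val_of_ne _ _ h, FilmIndex.update_val_of_ne _ _ h.symm,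
    FilmIndex.update_comm _ _ _ h]
  ring

theorem IsPureAt.insertSlot (h : IsPureAt i t Φ) (hst : s ≠ t) (x : H) :
    IsPureAt i t (insertSlot e i s x Φ) := by
  intro p hp
  rw [insertSlot_apply, h _ (by rwa [FilmIndex.update_val_of_ne _ _ hst.symm]), mul_zero]

/-- With `m = ⟨e i, x⟩` this separates the part along `Φ` from the part that integrates to zero. -/
theorem IsPureAt.insertSlot_eq (h : IsPureAt i s Φ) (x : H) (m : ℂ) :
    FeynmanDyson.insertSlot e i s x Φ =
      m • Φ + FeynmanDyson.insertSlot e i s (x - m • e i) Φ := by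
  ext p
  simp only [lp.coeFn_add, lp.coeFn_smul, Pi.add_apply, Pi.smul_apply, insertSlot_apply, map_sub,
    map_smul, lp.coeFn_sub, Pi.sub_apply, smul_eq_mul]
  by_cases hp : p.val s = i
  · rw [FilmIndex.update_eq_self hp, hp, repr_basis_self]
    ring
  · rw [repr_basis_of_ne hp, h p hp]
    ring

/-- At each label, either slot `t` carries `e i` and the second vector vanishes there, or it does
not and the first vanishes. -/
theorem IsPureAt.inner_insertSlot_eq_zero (h : IsPureAt i t Φ) (hst : s ≠ t) (x y : H)
    (hy : e.repr y i = 0) :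
    inner ℂ (FeynmanDyson.insertSlot e i s x Φ) (FeynmanDyson.insertSlot e i t y Φ) = 0 := by
  rw [lp.inner_eq_tsum]
  refine (tsum_congr fun p => ?_).trans tsum_zero
  rw [insertSlot_apply, insertSlot_apply]
  by_cases hp : p.val t = i
  · simp [hp, hy]
  · rw [h (p.update s i) (by rwa [FilmIndex.update_val_of_ne _ _ hst.symm])]
    simp

theorem IsPureAt.timeOrderedOp (h : IsPureAt i s Φ) {T : H →ₗ.[ℂ] H} (hi : e i ∈ T.domain) :
    TimeOrderedOp e T s Φ (FeynmanDyson.insertSlot e i s (T ⟨e i, hi⟩) Φ) := by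
  intro p
  refine ⟨Φ (p.update s i) • ⟨e i, hi⟩, fun k => ?_, fun k => ?_⟩
  · rw [Submodule.coe_smul, map_smul, lp.coeFn_smul, Pi.smul_apply, smul_eq_mul]
    by_cases hk : k = i
    · rw [hk, repr_basis_self, mul_one]
    · rw [repr_basis_of_ne hk, mul_zero, h _ (by simpa using hk)]
  · rw [T.map_smul, map_smul, lp.coeFn_smul, Pi.smul_apply, smul_eq_mul, insertSlot_apply,
      FilmIndex.update_update, FilmIndex.update_val_self, mul_comm]

end Insert

/-- The vector `A s (e i)`, or `0` where `e i` is not in the domain of `A s`. -/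
def slotVector (e : HilbertBasis ι ℂ H) (A : Set.Icc a b → H →ₗ.[ℂ] H) (i : ι)
    (s : Set.Icc a b) : H :=
  open Classical in if h : e i ∈ (A s).domain then A s ⟨e i, h⟩ else 0

/-- The function `s ↦ ⟨e i, A s (e i)⟩`. -/
def slotMean (e : HilbertBasis ι ℂ H) (A : Set.Icc a b → H →ₗ.[ℂ] H) (i : ι) (s : ℝ) : ℂ :=
  open Classical in if h : s ∈ Set.Icc a b then e.repr (slotVector e A i ⟨s, h⟩) i else 0

/-- Replace the basis vector `e i` by `A s (e i)` in each slot `s` of the list. -/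
def insertSlots (e : HilbertBasis ι ℂ H) (A : Set.Icc a b → H →ₗ.[ℂ] H) (i : ι)
    (l : List (Set.Icc a b)) (Φ : FDSpace a b ι) : FDSpace a b ι :=
  l.foldr (fun s Θ => insertSlot e i s (slotVector e A i s) Θ) Φ

/-! ### Iterated integrals of vectors pure off a countable set -/

section Pure

variable {e : HilbertBasis ι ℂ H} {A : Set.Icc a b → H →ₗ.[ℂ] H} {i : ι} {Φ : FDSpace a b ι}

theorem slotVector_of_mem {s : Set.Icc a b} (h : e i ∈ (A s).domain) :
    slotVector e A i s = A s ⟨e i, h⟩ := dif_pos h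

theorem slotMean_of_mem (s : Set.Icc a b) :
    slotMean e A i s = e.repr (slotVector e A i s) i := dif_pos s.2

theorem insertSlots_insertSlot {s : Set.Icc a b} (x : H) : ∀ {l : List (Set.Icc a b)}, s ∉ l →
    insertSlots e A i l (insertSlot e i s x Φ) = insertSlot e i s x (insertSlots e A i l Φ)
  | [], _ => rfl
  | r :: l, h => by
    rw [List.mem_cons, not_or] at h
    have ih := insertSlots_insertSlot x h.2
    simp only [insertSlots, List.foldr_cons] at ih ⊢
    rw [ih, insertSlot_comm (Ne.symm h.1)]

theorem IsPureAt.insertSlots {s : Set.Icc a b} (h : IsPureAt i s Φ) :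
    ∀ {l : List (Set.Icc a b)}, s ∉ l → IsPureAt i s (insertSlots e A i l Φ)
  | [], _ => h
  | r :: l, hs => by
    rw [List.mem_cons, not_or] at hs
    exact (h.insertSlots hs.2).insertSlot (Ne.symm hs.1) _

/-- Since the times are distinct, slot `s` still carries `e i` when `𝒜(s)` acts. -/
theorem timeOrderedProd_insertSlots {N : Set (Set.Icc a b)} (hΦ : ∀ s ∉ N, IsPureAt i s Φ)
    (hN : ∀ s ∉ N, e i ∈ (A s).domain) : ∀ l : List (Set.Icc a b), l.Nodup → (∀ s ∈ l, s ∉ N) →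
      TimeOrderedProd e A Φ l (insertSlots e A i l Φ)
  | [], _, _ => rfl
  | s :: l, hl, hlN => by
    have hs := hlN s List.mem_cons_self
    rw [List.nodup_cons] at hl
    refine ⟨_, timeOrderedProd_insertSlots hΦ hN l hl.2 fun r hr =>
      hlN r (List.mem_cons_of_mem _ hr), ?_⟩
    have := ((hΦ s hs).insertSlots (e := e) (A := A) hl.1).timeOrderedOp (hN s hs)
    rwa [← slotVector_of_mem] at this

variable {c : ℝ → ℂ}

/-- The components of `𝒜(s) Φ` orthogonal to `Φ` do not contribute to the integral. -/
theorem hasHKIntegral_insertSlot {N : Set (Set.Icc a b)} (hΦ : ∀ s ∉ N, IsPureAt i s Φ)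
    (hN : N.Countable) {f : ℝ → ℂ} {t : Set.Icc a b} {v : ℂ}
    (hf : HasHKIntegral (fun s => f s * slotMean e A i s) a t v) {G : ℝ → FDSpace a b ι}
    (hG : ∀ s : Set.Icc a b, s ∉ N → G s = f s • insertSlot e i s (slotVector e A i s) Φ) :
    HasHKIntegral G a t (v • Φ) := by
  classical
  -- The centred part of the integrand, set to zero at exceptional times so that orthogonality holds
  -- for all pairs of reals.
  set R : ℝ → FDSpace a b ι := fun r =>
    if h : ∃ hr : r ∈ Set.Icc a b, (⟨r, hr⟩ : Set.Icc a b) ∉ N then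
      f r • insertSlot e i ⟨r, h.1⟩ (slotVector e A i ⟨r, h.1⟩ - slotMean e A i r • e i) Φ
    else 0 with hR
  have hRort : ∀ s s', s ≠ s' → inner ℂ (R s) (R s') = 0 := by
    intro s s' hss
    by_cases h : ∃ hr : s ∈ Set.Icc a b, (⟨s, hr⟩ : Set.Icc a b) ∉ N
    swap
    · simp only [hR]; rw [dif_neg h, inner_zero_left]
    by_cases h' : ∃ hr : s' ∈ Set.Icc a b, (⟨s', hr⟩ : Set.Icc a b) ∉ N
    swap
    · simp only [hR]; rw [dif_neg h', inner_zero_right]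
    simp only [hR]
    rw [dif_pos h, dif_pos h', inner_smul_left, inner_smul_right,
      (hΦ _ h'.2).inner_insertSlot_eq_zero (fun h => hss (congrArg Subtype.val h))]
    · simp
    · rw [map_sub, map_smul, lp.coeFn_sub, lp.coeFn_smul, Pi.sub_apply, Pi.smul_apply,
        repr_basis_self, slotMean, dif_pos h'.1]
      simp
  have h1 := (hf.smul_const Φ).add (hasHKIntegral_zero_of_orthogonal a t hRort)
  rw [add_zero] at h1
  refine h1.congr (hN.image Subtype.val) fun s hs hsN => ?_
  have hr : s ∈ Set.Icc a b := ⟨hs.1, hs.2.trans t.2.2⟩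
  have hσ : (⟨s, hr⟩ : Set.Icc a b) ∉ N := fun h => hsN ⟨_, h, rfl⟩
  have h2 := hG ⟨s, hr⟩ hσ
  rw [(hΦ _ hσ).insertSlot_eq _ (slotMean e A i s)] at h2
  simp only [hR]
  rw [dif_pos ⟨hr, hσ⟩, h2, smul_add, smul_smul]

/-- Induction on `k`, with the outermost time `s` fixed. The insertion at `s` commutes past the
others, so the inner integral is the same problem for a vector pure off `N ∪ {s}`. It gives `c s ^ k
/ k!` times that vector, and the outer integral keeps only the mean. -/
theorem hasIteratedIntegral_insertSlots (hab : a ≤ b)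
    (hc : ∀ t ∈ Set.Icc a b, HasHKIntegral (slotMean e A i) a t (c t)) :
    ∀ {k : ℕ} {t : Set.Icc a b} {Φ : FDSpace a b ι} {N : Set (Set.Icc a b)}
      {F : List (Set.Icc a b) → FDSpace a b ι → Prop}, N.Countable → (∀ s ∉ N, IsPureAt i s Φ) →
      (∀ l : List (Set.Icc a b), l.Nodup → (∀ s ∈ l, s ∉ N) → F l (insertSlots e A i l Φ)) →
      HasIteratedIntegral k t F ((c t ^ k / (k.factorial : ℂ)) • Φ)
  | 0, t, Φ, N, F, _, _, hF => by
    have := hF [] List.nodup_nil (by simp)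
    simpa [HasIteratedIntegral, insertSlots] using this
  | k + 1, t, Φ, N, F, hN, hΦ, hF => by
    classical
    refine ⟨fun r => if hr : r ∈ Set.Icc a b then (c r ^ k / (k.factorial : ℂ)) •
      insertSlot e i ⟨r, hr⟩ (slotVector e A i ⟨r, hr⟩) Φ else 0, ⟨N, hN, fun s _ hsN => ?_⟩, ?_⟩
    · beta_reduce
      rw [dif_pos s.2]
      refine hasIteratedIntegral_insertSlots hab hc (hN.insert s) ?_ ?_
      · intro r hr
        rw [Set.mem_insert_iff, not_or] at hr
        exact (hΦ r hr.2).insertSlot (Ne.symm hr.1) _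
      · intro l hl hlN
        have hsl : s ∉ l := fun h => hlN s h (Set.mem_insert _ _)
        rw [insertSlots_insertSlot _ hsl]
        refine hF (s :: l) (List.nodup_cons.2 ⟨hsl, hl⟩) fun r hr => ?_
        rcases List.mem_cons.1 hr with rfl | hr
        · exact hsN
        · exact fun h => hlN r hr (Set.mem_insert_of_mem _ h)
    · refine hasHKIntegral_insertSlot hΦ hN (hasHKIntegral_pow_div_factorial hc hab k t.2) ?_
      exact fun s _ => dif_pos s.2

end Pure

end Film

/-! ### The time-ordered integrals as diagonal operators -/

section Diagonal

variable {H : Type*} [NormedAddCommGroup H] [InnerProductSpace ℂ H]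
variable {ι : Type*} {a b : ℝ} {e : HilbertBasis ι ℂ H} {A : Set.Icc a b → H →ₗ.[ℂ] H}

theorem IsElementaryTensor.isPureAt {i : ι} {φ : Set.Icc a b → H} {Φ : FDSpace a b ι}
    (h : IsElementaryTensor e i φ Φ) {s : Set.Icc a b} (hs : φ s = e i) : IsPureAt i s Φ := by
  intro p hp
  by_cases hb : p.base = i
  swap
  · exact h.2.2 p hb
  rw [h.2.1 p hb]
  -- `finprod` defaults to `1` on infinite support, so finiteness must come before the vanishing
  -- factor can be used.
  have hfin : ({t | φ t ≠ e i} ∪ {t | p.val t ≠ p.base}).Finite := h.1.union p.finite'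
  rw [finprod_eq_prod_of_mulSupport_subset (s := insert s hfin.toFinset)]
  · refine Finset.prod_eq_zero (Finset.mem_insert_self _ _) ?_
    rw [hs, repr_basis_of_ne hp]
  · intro t ht
    rw [Finset.coe_insert, Set.Finite.coe_toFinset]
    refine Set.mem_insert_of_mem _ ?_
    by_contra hcon
    rw [Set.mem_union, not_or, Set.mem_ofPred_eq, Set.mem_ofPred_eq, not_not, not_not] at hcon
    refine ht ?_
    beta_reduce
    rw [hcon.1, hcon.2, hb, repr_basis_self]

/-- Induction on the core `D₀`. -/
theorem coreDomain_induction {motive : ∀ Φ : FDSpace a b ι, Φ ∈ coreDomain e A → Prop}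
    (pure : ∀ (i : ι) (Φ : FDSpace a b ι) (N : Set (Set.Icc a b)), N.Countable →
      (∀ s ∉ N, IsPureAt i s Φ) → (∀ s ∉ N, e i ∈ (A s).domain) → (∀ p, p.base ≠ i → Φ p = 0) →
      ∀ hΦ, motive Φ hΦ)
    (zero : motive 0 (zero_mem _))
    (add : ∀ Φ Ψ hΦ hΨ, motive Φ hΦ → motive Ψ hΨ → motive (Φ + Ψ) (add_mem hΦ hΨ))
    (smul : ∀ (z : ℂ) Φ hΦ, motive Φ hΦ → motive (z • Φ) (Submodule.smul_mem _ z hΦ))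
    {Φ : FDSpace a b ι} (hΦ : Φ ∈ coreDomain e A) : motive Φ hΦ := by
  refine Submodule.span_induction (fun Φ h => ?_) zero add smul hΦ
  obtain ⟨i, φ, hφ, hT⟩ := id h
  refine pure i Φ {t | φ t ≠ e i} hT.1.countable (fun s hs => hT.isPureAt (not_not.1 hs))
    (fun s hs => ?_) hT.2.2 _
  rw [← not_not.1 hs]
  exact hφ s

/-- For all but countably many `s`, slot `s` holds the reference vector both in the label `p` and in
the pure vectors that make up `Φ`, so the coordinate at `p` sees only a diagonal matrix element. -/
theorem exists_timeOrderedOp_coord {Φ : FDSpace a b ι} (hΦ : Φ ∈ coreDomain e A)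
    (p : FilmIndex a b ι) : ∃ C : Set (Set.Icc a b), C.Countable ∧ ∀ s ∉ C, ∃ Ψ,
      TimeOrderedOp e (A s) s Φ Ψ ∧ Ψ p = slotMean e A p.base s * Φ p := by
  induction hΦ using coreDomain_induction with
  | pure i Φ N hN hpure hdom hbase _ =>
    refine ⟨N ∪ {t | p.val t ≠ p.base}, hN.union p.finite'.countable, fun s hs => ?_⟩
    rw [Set.mem_union, not_or, Set.mem_ofPred_eq, not_not] at hs
    refine ⟨_, (hpure s hs.1).timeOrderedOp (hdom s hs.1), ?_⟩
    rw [insertSlot_apply, ← slotVector_of_mem]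
    by_cases hp : p.base = i
    · rw [FilmIndex.update_eq_self (hs.2.trans hp), slotMean_of_mem, hs.2, hp]
    · rw [hbase p hp, hbase _ (by simpa using hp), mul_zero, mul_zero]
  | zero => exact ⟨∅, Set.countable_empty, fun s _ => ⟨0, timeOrderedOp_zero, by simp⟩⟩
  | add Φ Φ' _ _ h h' =>
    obtain ⟨C, hC, h⟩ := h
    obtain ⟨C', hC', h'⟩ := h'
    refine ⟨C ∪ C', hC.union hC', fun s hs => ?_⟩
    rw [Set.mem_union, not_or] at hs
    obtain ⟨Ψ, h1, h2⟩ := h s hs.1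
    obtain ⟨Ψ', h1', h2'⟩ := h' s hs.2
    exact ⟨_, h1.add h1', by simp [h2, h2', mul_add]⟩
  | smul z Φ _ h =>
    obtain ⟨C, hC, h⟩ := h
    refine ⟨C, hC, fun s hs => ?_⟩
    obtain ⟨Ψ, h1, h2⟩ := h s hs
    exact ⟨_, h1.const_smul z, by simp [h2, mul_left_comm]⟩

/-- The coordinate functional at `p`. -/
def coordCLM (p : FilmIndex a b ι) : FDSpace a b ι →L[ℂ] ℂ :=
  lp.evalCLM ℂ (fun _ : FilmIndex a b ι => ℂ) 2 p

theorem coordCLM_apply (p : FilmIndex a b ι) (Φ : FDSpace a b ι) : coordCLM p Φ = Φ p := rfl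

/-- Apply the coordinate functional at `p` to the vector integral and divide by `Φ p`. -/
theorem exists_hasHKIntegral_slotMean {Φ Ψ : FDSpace a b ι} (hΦ : Φ ∈ coreDomain e A)
    {t : Set.Icc a b} (h : HasTimeOrderedIntegral e A 1 t Φ Ψ) {p : FilmIndex a b ι}
    (hp : Φ p ≠ 0) : ∃ v, HasHKIntegral (slotMean e A p.base) a t v := by
  obtain ⟨G, ⟨N, hN, hG⟩, hv⟩ := h
  obtain ⟨C, hC, hmean⟩ := exists_timeOrderedOp_coord hΦ p
  refine ⟨_, ((hv.map (coordCLM p)).const_smul (Φ p)⁻¹).congr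
    ((hN.union hC).image Subtype.val) fun s hs hsN => ?_⟩
  set σ : Set.Icc a b := ⟨s, hs.1, hs.2.trans t.2.2⟩
  have hσ : σ ∉ N ∪ C := fun h => hsN ⟨σ, h, rfl⟩
  rw [Set.mem_union, not_or] at hσ
  obtain ⟨Θ, hΘ, hop⟩ := hG σ hs.2 hσ.1
  cases hΘ
  obtain ⟨Ψ', hop', hcoord⟩ := hmean σ hσ.2
  have h1 : G s p = slotMean e A p.base s * Φ p := by
    rw [← hcoord, ← hop.unique hop']
  rw [coordCLM_apply, h1, smul_eq_mul]
  field_simp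

theorem dense_coreDomain {t : Set.Icc a b}
    (hd : Dense ((timeOrderedQ e A t).domain : Set (FDSpace a b ι))) :
    Dense (coreDomain e A : Set (FDSpace a b ι)) := by
  have hle : timeOrderedIntegralGraph e A 1 t ≤
      (coreDomain e A).topologicalClosure.comap (LinearMap.fst ℂ _ _) := by
    refine Submodule.topologicalClosure_minimal _ (Submodule.span_le.2 fun z hz => ?_) ?_
    · exact Submodule.le_topologicalClosure _ hz.1
    · exact (Submodule.isClosed_topologicalClosure _).preimage continuous_fst
  have hsub : ((timeOrderedQ e A t).domain : Set (FDSpace a b ι)) ⊆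
      closure (coreDomain e A : Set (FDSpace a b ι)) := by
    rintro x ⟨z, hz, rfl⟩
    exact hle hz
  exact dense_closure.1 (hd.mono hsub)

/-- Otherwise every core vector with an integral vanishes at the constant label `i`. This survives
the closure, so a dense domain would lie in a proper closed subspace. -/
theorem exists_hasHKIntegral_slotMean_of_dense {t : Set.Icc a b}
    (hd : Dense ((timeOrderedQ e A t).domain : Set (FDSpace a b ι))) (i : ι) :
    ∃ v, HasHKIntegral (slotMean e A i) a t v := by
  classical
  set p : FilmIndex a b ι := ⟨i, fun _ => i, by simp⟩
  by_contra hcon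
  have hle : timeOrderedIntegralGraph e A 1 t ≤
      (LinearMap.ker (coordCLM p).toLinearMap).comap (LinearMap.fst ℂ _ _) := by
    refine Submodule.topologicalClosure_minimal _ (Submodule.span_le.2 fun z hz => ?_) ?_
    · by_contra hz0
      exact hcon (exists_hasHKIntegral_slotMean hz.1 hz.2 (p := p) hz0)
    · exact ((coordCLM p).isClosed_ker).preimage continuous_fst
  have hsub : ((timeOrderedQ e A t).domain : Set (FDSpace a b ι)) ⊆
      LinearMap.ker (coordCLM p).toLinearMap := by
    rintro x ⟨z, hz, rfl⟩
    exact hle hz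
  have hall : (LinearMap.ker (coordCLM p).toLinearMap : Set (FDSpace a b ι)) = Set.univ := by
    have := (hd.mono hsub).closure_eq
    rwa [((coordCLM p).isClosed_ker).closure_eq] at this
  have hmem : lp.single 2 p (1 : ℂ) ∈ (LinearMap.ker (coordCLM p).toLinearMap) := by
    rw [← SetLike.mem_coe, hall]; trivial
  have h1 : (lp.single 2 p (1 : ℂ) : FDSpace a b ι) p = 0 := hmem
  simp at h1

variable {c : ι → ℝ → ℂ}

theorem hasTimeOrderedIntegral_coreDomain (hab : a ≤ b)
    (hc : ∀ i, ∀ t ∈ Set.Icc a b, HasHKIntegral (slotMean e A i) a t (c i t))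
    (k : ℕ) (t : Set.Icc a b) {Φ : FDSpace a b ι} (hΦ : Φ ∈ coreDomain e A) :
    ∃ Ψ, HasTimeOrderedIntegral e A k t Φ Ψ ∧
      ∀ p, Ψ p = c p.base t ^ k / (k.factorial : ℂ) * Φ p := by
  induction hΦ using coreDomain_induction with
  | pure i Φ N hN hpure hdom hbase _ =>
    refine ⟨_, hasIteratedIntegral_insertSlots hab (hc i) hN hpure
      (timeOrderedProd_insertSlots hpure hdom), fun p => ?_⟩
    rw [lp.coeFn_smul, Pi.smul_apply, smul_eq_mul]
    by_cases hp : p.base = i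
    · rw [hp]
    · rw [hbase p hp, mul_zero, mul_zero]
  | zero => exact ⟨0, hasIteratedIntegral_zero timeOrderedProd_zero, by simp⟩
  | add Φ Φ' _ _ h h' =>
    obtain ⟨Ψ, h1, h2⟩ := h
    obtain ⟨Ψ', h1', h2'⟩ := h'
    exact ⟨_, h1.add TimeOrderedProd.add h1', by simp [h2, h2', mul_add]⟩
  | smul z Φ _ h =>
    obtain ⟨Ψ, h1, h2⟩ := h
    exact ⟨_, h1.const_smul z (TimeOrderedProd.const_smul z), by simp [h2, mul_left_comm]⟩

/-- The vectors of the film with vanishing components outside the summand with reference vector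
`Eⁱ`. -/
def baseSubspace (a b : ℝ) (i : ι) : Submodule ℂ (FDSpace a b ι) :=
  ⨅ p : {p : FilmIndex a b ι // p.base ≠ i}, LinearMap.ker (coordCLM p.1).toLinearMap

theorem mem_baseSubspace {i : ι} {Φ : FDSpace a b ι} :
    Φ ∈ baseSubspace a b i ↔ ∀ p, p.base ≠ i → Φ p = 0 := by
  simp only [baseSubspace, Submodule.mem_iInf, Subtype.forall]
  rfl

instance completeSpace_baseSubspace (i : ι) : CompleteSpace (baseSubspace a b i) := by
  have : IsClosed (baseSubspace a b i : Set (FDSpace a b ι)) := by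
    rw [baseSubspace, Submodule.coe_iInf]
    exact isClosed_iInter fun p => (coordCLM p.1).isClosed_ker
  exact this.completeSpace_coe

/-- Density of the core is known only in the whole film. Orthogonal projection onto the summand
carries it over: it fixes the generating tensors based at `i` and kills the others, and the graph is
closed. -/
theorem timeOrderedIntegralGraph_single_mem (hab : a ≤ b)
    (hc : ∀ i, ∀ t ∈ Set.Icc a b, HasHKIntegral (slotMean e A i) a t (c i t))
    (hd : Dense (coreDomain e A : Set (FDSpace a b ι))) (k : ℕ) (t : Set.Icc a b)
    {i : ι} {Φ : FDSpace a b ι} (hΦ : Φ ∈ baseSubspace a b i) :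
    (Φ, (c i t ^ k / (k.factorial : ℂ)) • Φ) ∈ timeOrderedIntegralGraph e A k t := by
  set K := baseSubspace a b i
  set z := c i t ^ k / (k.factorial : ℂ)
  have hclosed : IsClosed {Θ | (K.starProjection Θ, z • K.starProjection Θ) ∈
      timeOrderedIntegralGraph e A k t} :=
    (Submodule.isClosed_topologicalClosure _).preimage (by fun_prop)
  have hcore : (coreDomain e A : Set (FDSpace a b ι)) ⊆
      {Θ | (K.starProjection Θ, z • K.starProjection Θ) ∈ timeOrderedIntegralGraph e A k t} := by
    intro Θ hΘ
    rw [Set.mem_ofPred_eq]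
    induction hΘ using coreDomain_induction with
    | pure j Θ N hN hpure hdom hbase hmem =>
      by_cases hj : j = i
      · subst hj
        rw [Submodule.starProjection_eq_self_iff.2 (mem_baseSubspace.2 hbase)]
        refine Submodule.le_topologicalClosure _ (Submodule.subset_span ⟨hmem, ?_⟩)
        exact hasIteratedIntegral_insertSlots hab (hc j) hN hpure
          (timeOrderedProd_insertSlots hpure hdom)
      · have h0 : K.starProjection Θ = 0 := by
          rw [Submodule.starProjection_apply_eq_zero_iff, Submodule.mem_orthogonal]
          intro u hu
          rw [lp.inner_eq_tsum]
          refine (tsum_congr fun p => ?_).trans tsum_zero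
          by_cases hp : p.base = i
          · rw [hbase p (by rw [hp]; exact Ne.symm hj), inner_zero_right]
          · rw [mem_baseSubspace.1 hu p hp, inner_zero_left]
        rw [h0, smul_zero]
        exact zero_mem _
    | zero => rw [map_zero, smul_zero]; exact zero_mem _
    | add Θ Θ' _ _ h h' =>
      rw [map_add, smul_add]
      exact add_mem h h'
    | smul r Θ _ h =>
      rw [map_smul, smul_comm]
      exact Submodule.smul_mem _ r h
  have hall := closure_minimal hcore hclosed (hd Φ)
  rwa [Set.mem_ofPred_eq, Submodule.starProjection_eq_self_iff.2 hΦ] at hall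

/-- The `k`-fold time-ordered integral acts on the summand with reference vector `Eⁱ` as
multiplication by `(∫ₐᵗ ⟨eⁱ, A s eⁱ⟩ ds) ^ k / k!`. -/
theorem mem_timeOrderedIntegralGraph (hab : a ≤ b)
    (hc : ∀ i, ∀ t ∈ Set.Icc a b, HasHKIntegral (slotMean e A i) a t (c i t))
    (hd : Dense (coreDomain e A : Set (FDSpace a b ι))) (k : ℕ) (t : Set.Icc a b)
    (z : FDSpace a b ι × FDSpace a b ι) : z ∈ timeOrderedIntegralGraph e A k t ↔
      ∀ p, z.2 p = c p.base t ^ k / (k.factorial : ℂ) * z.1 p := by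
  classical
  constructor
  · intro hz p
    set L : FDSpace a b ι × FDSpace a b ι →L[ℂ] ℂ :=
      (coordCLM p).comp (ContinuousLinearMap.snd ℂ _ _) - (c p.base t ^ k / (k.factorial : ℂ)) •
        (coordCLM p).comp (ContinuousLinearMap.fst ℂ _ _)
    have hle : timeOrderedIntegralGraph e A k t ≤ LinearMap.ker L.toLinearMap := by
      refine Submodule.topologicalClosure_minimal _ (Submodule.span_le.2 fun z hz => ?_)
        L.isClosed_ker
      obtain ⟨Ψ, h1, h2⟩ := hasTimeOrderedIntegral_coreDomain hab hc k t hz.1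
      have h3 : z.2 = Ψ := HasIteratedIntegral.unique TimeOrderedProd.unique hz.2 h1
      change z.2 p - c p.base t ^ k / (k.factorial : ℂ) * z.1 p = 0
      rw [h3, h2, sub_self]
    exact sub_eq_zero.1 (hle hz)
  · intro hz
    -- Both components are sums of their basis components, each in a single summand; closedness of
    -- the graph allows passage to the limit.
    have h1 := (lp.hasSum_single (p := 2) (by norm_num) z.1).prodMk
      (lp.hasSum_single (p := 2) (by norm_num) z.2)
    refine (Submodule.isClosed_topologicalClosure _).mem_of_tendsto h1
      (Eventually.of_forall fun F => Submodule.sum_mem _ fun p _ => ?_)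
    have hmem : (lp.single 2 p (z.1 p) : FDSpace a b ι) ∈ baseSubspace a b p.base := by
      refine mem_baseSubspace.2 fun q hq => ?_
      rw [lp.single_apply_ne]
      rintro rfl
      exact hq rfl
    have h2 := timeOrderedIntegralGraph_single_mem hab hc hd k t hmem
    rwa [← lp.single_smul, smul_eq_mul, ← hz p] at h2

/-- This is closability: the closed graph is single-valued because its second component is a
coordinatewise multiple of the first. -/
theorem timeOrderedIntegral_graph_eq (hab : a ≤ b)
    (hc : ∀ i, ∀ t ∈ Set.Icc a b, HasHKIntegral (slotMean e A i) a t (c i t))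
    (hd : Dense (coreDomain e A : Set (FDSpace a b ι))) (k : ℕ) (t : Set.Icc a b) :
    (timeOrderedIntegral e A k t).graph = timeOrderedIntegralGraph e A k t := by
  refine Submodule.toLinearPMap_graph_eq _ fun z hz hz0 => ?_
  ext p
  rw [(mem_timeOrderedIntegralGraph hab hc hd k t z).1 hz p, hz0]
  simp

/-- The iterated integral is the scaled power of `𝐐[t, a]` on the domain of the power. -/
theorem mem_timeOrderedIntegral_graph_of_chain (hab : a ≤ b)
    (hc : ∀ i, ∀ t ∈ Set.Icc a b, HasHKIntegral (slotMean e A i) a t (c i t))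
    (hd : Dense (coreDomain e A : Set (FDSpace a b ι))) {t : Set.Icc a b} {k : ℕ}
    {z : ℕ → FDSpace a b ι} (hz : ∀ j < k, (z j, z (j + 1)) ∈ (timeOrderedQ e A t).graph) :
    (z 0, (k.factorial : ℂ)⁻¹ • z k) ∈ (timeOrderedIntegral e A k t).graph := by
  have hpow : ∀ j ≤ k, ∀ p, z j p = c p.base t ^ j * z 0 p := by
    intro j
    induction j with
    | zero => simp
    | succ j ih =>
      intro hj p
      have h := hz j (by omega)
      rw [timeOrderedQ, timeOrderedIntegral_graph_eq hab hc hd,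
        mem_timeOrderedIntegralGraph hab hc hd] at h
      have h1 := h p
      simp only [pow_one, Nat.factorial_one, Nat.cast_one, div_one] at h1
      rw [h1, ih (by omega)]
      ring
  rw [timeOrderedIntegral_graph_eq hab hc hd, mem_timeOrderedIntegralGraph hab hc hd]
  intro p
  rw [lp.coeFn_smul, Pi.smul_apply, hpow k le_rfl, smul_eq_mul]
  ring

end Diagonal
end FeynmanDyson

end

/-! ### The main theorem -/

open FeynmanDyson in
theorem theorem7p12 {H : Type*} [NormedAddCommGroup H] [InnerProductSpace ℂ H] [CompleteSpace H]
    {ι : Type*} (e : HilbertBasis ι ℂ H) {a b : ℝ} (hab : a < b)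
    (A : Set.Icc a b → H →ₗ.[ℂ] H)
    (hA : ∀ t, ∃ S : ℝ → H →L[ℂ] H, IsC0Semigroup S ∧ IsGeneratorOf (A t) S)
    (U : Set.Icc a b → ℝ → FDSpace a b ι →L[ℂ] FDSpace a b ι)
    (hU : ∀ t, IsC0ContractionSemigroup (U t) ∧ IsGeneratorOf (timeOrderedQ e A t) (U t)) :
    (∀ t, IsPoincareAsymptotic (timeOrderedQ e A t) (U t)) ∧
    (∀ (k : ℕ) (t : Set.Icc a b),
      (∀ Φ ∈ coreDomain e A, ∃ Ψ, HasTimeOrderedIntegral e A k t Φ Ψ) ∧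
      (timeOrderedIntegral e A k t).graph = timeOrderedIntegralGraph e A k t) ∧
    (∀ (t : Set.Icc a b) (n : ℕ) (Φ : FDSpace a b ι),
      (∃ Ψ, IsPow (timeOrderedQ e A t) (n + 1) Φ Ψ) →
      ∀ w : ℝ, 0 ≤ w →
      ∃ (y : ℕ → FDSpace a b ι) (r : ℝ → FDSpace a b ι),
        (∀ k ∈ Finset.Icc 1 n, (Φ, y k) ∈ (timeOrderedIntegral e A k t).graph) ∧
        (∀ ξ ∈ Set.Icc 0 w, (U t ξ Φ, r ξ) ∈ (timeOrderedIntegral e A (n + 1) t).graph) ∧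
        IntervalIntegrable (fun ξ : ℝ => (((w - ξ) ^ n : ℝ) : ℂ) • r ξ) volume 0 w ∧
        U t w Φ = Φ + ∑ k ∈ Finset.Icc 1 n, (w : ℂ) ^ k • y k
          + ((n : ℂ) + 1) • ∫ ξ in (0 : ℝ)..w, (((w - ξ) ^ n : ℝ) : ℂ) • r ξ) := by
  classical
  have hdense : ∀ t, Dense ((timeOrderedQ e A t).domain : Set (FDSpace a b ι)) := fun t =>
    (hU t).2.dense_domain (hU t).1.toIsC0Semigroup
  have hd := dense_coreDomain (hdense ⟨a, le_rfl, hab.le⟩)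
  choose v hv using fun (i : ι) (t : Set.Icc a b) =>
    exists_hasHKIntegral_slotMean_of_dense (hdense t) i
  set c : ι → ℝ → ℂ := fun i s => if h : s ∈ Set.Icc a b then v i ⟨s, h⟩ else 0 with hc_def
  have hc : ∀ i, ∀ t ∈ Set.Icc a b, HasHKIntegral (slotMean e A i) a t (c i t) := by
    intro i t ht
    simp only [hc_def]
    rw [dif_pos ht]
    exact hv i ⟨t, ht⟩
  refine ⟨fun t => (hU t).2.isPoincareAsymptotic (hU t).1.toIsC0Semigroup, fun k t =>
    ⟨fun Φ hΦ => ?_, timeOrderedIntegral_graph_eq hab.le hc hd k t⟩, ?_⟩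
  · obtain ⟨Ψ, h, _⟩ := hasTimeOrderedIntegral_coreDomain hab.le hc k t hΦ
    exact ⟨Ψ, h⟩
  rintro t n Φ ⟨Ψ, hΨ⟩ w hw
  have hS := (hU t).1.toIsC0Semigroup
  have hQ := (hU t).2
  obtain ⟨z, rfl, hz⟩ := hΨ.exists_chain
  -- Splitting `(n + 1)!` as `(n + 1) * n!` produces the factor that cancels the prefactor `n + 1`
  -- of the remainder.
  have hcast : ∀ ξ : ℝ, (((w - ξ) ^ n : ℝ) : ℂ) • ((n + 1).factorial : ℂ)⁻¹ • U t ξ (z (n + 1)) =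
      ((n : ℝ) + 1)⁻¹ • ((w - ξ) ^ n / (n.factorial : ℝ)) • U t ξ (z (n + 1)) := by
    intro ξ
    rw [← ofReal_smul, ← ofReal_smul, smul_smul, smul_smul, Nat.factorial_succ]
    congr 1
    push_cast
    rw [mul_inv]
    ring
  -- The witnesses are `𝐐 ^ k Φ / k!` and `U ^ ξ 𝐐 ^ (n + 1) Φ / (n + 1)!`; the latter is the
  -- integral applied to `U ^ ξ Φ` because the semigroup commutes with its generator.
  refine ⟨fun k => (k.factorial : ℂ)⁻¹ • z k,
    fun ξ => ((n + 1).factorial : ℂ)⁻¹ • U t ξ (z (n + 1)), fun k hk => ?_, fun ξ hξ => ?_, ?_, ?_⟩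
  · rw [Finset.mem_Icc] at hk
    exact mem_timeOrderedIntegral_graph_of_chain hab.le hc hd fun j hj => hz j (by omega)
  · exact mem_timeOrderedIntegral_graph_of_chain hab.le hc hd (z := fun j => U t ξ (z j))
      fun j hj => hQ.map_mem hS (hz j hj) hξ.1
  · simp only [hcast]
    refine ContinuousOn.intervalIntegrable (ContinuousOn.fun_const_smul
      ((hS.continuousOn_taylor_remainder w n _).mono ?_) _)
    rw [Set.uIcc_of_le hw]
    exact fun ξ hξ => hξ.1
  · simp only [hcast]
    rw [intervalIntegral.integral_smul, hQ.taylor hS hw n hz, Finset.sum_range_succ',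
      ← ofReal_smul, smul_smul]
    have hn : ((n : ℂ) + 1) * (((n : ℝ) + 1)⁻¹ : ℝ) = 1 := by
      push_cast
      exact mul_inv_cancel₀ (Nat.cast_add_one_ne_zero n)
    rw [hn, one_smul]
    have hsum : ∑ k ∈ Finset.Icc 1 n, (w : ℂ) ^ k • (k.factorial : ℂ)⁻¹ • z k =
        ∑ k ∈ Finset.range n, (w ^ (k + 1) / ((k + 1).factorial : ℝ)) • z (k + 1) := by
      rw [Finset.range_eq_Ico, Finset.sum_Ico_add' (fun k =>
        (w ^ k / (k.factorial : ℝ)) • z k) 0 n 1]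
      refine Finset.sum_congr (by ext; simp) fun k _ => ?_
      rw [← ofReal_smul, smul_smul]
      push_cast
      rfl
    rw [hsum]
    simp only [pow_zero, Nat.factorial_zero, Nat.cast_one, div_one, one_smul]
    abel
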